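/- **Theorem.** Consider unoriented link diagrams in $\mathbb{R}^2$ or in $S^2$ (generic immersed closed curves with over/under information at the double points; a link has at least one component). Two diagrams are *equivalent* if they are ambient isotopic in $\mathbb{R}^2$ (respectively $S^2$). Write $\mathrm{RI}_-$ for the Reidemeister move I that removes one crossing (it removes a kink, i.e. a loop of the curve bounding a monogonal region), and $\mathrm{RII}_-$ for the Reidemeister move II that removes two crossings (it pulls apart two strands bounding a bigonal region, one of them passing over the other at both corners of the bigon). Call a diagram *minimal* if neither $\mathrm{RI}_-$ nor $\mathrm{RII}_-$ can be applied to it. Let $D$ be a diagram, in $\mathbb{R}^2$ or in $S^2$, of a link without a split unknot component, i.e. a link having no diagram in which some component has no crossings and at least one other component is present. If $D_1$ and $D_2$ are minimal diagrams, each obtained from $D$ by applying finitely many (possibly zero) moves $\mathrm{RI}_-$ and $\mathrm{RII}_-$, then $D_1$ and $D_2$ are equivalent. -/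

import Mathlib

/-!
Link diagrams in the plane or on the sphere, in combinatorial form.

A link diagram is a closed curve system with finitely many transverse double points, together with
over/under information, considered up to ambient isotopy of the surface.  It is recorded as a graph
drawn on the surface: the vertices are the crossings (4-valent) and finitely many auxiliary bivalent
points on the curves.  Every closed curve carries at least one vertex, so a crossingless circle
carries only bivalent points.  Adding or forgetting auxiliary points is part of the notion of
isotopy.  A drawn graph, connected or not, is determined up to orientation-preserving
homeomorphism by the cyclic order of the edge ends at each vertex, the pairing of edge ends into
edges, and the knowledge of which sides of edges belong to the same region.
-/

/-- The two surfaces in which diagrams are drawn. -/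
inductive Ambient where
  | plane
  | sphere

/-- A (nonempty, unoriented) link diagram in the plane or on the sphere. A plane diagram is a
diagram on the sphere together with the region that contains the point at infinity. -/
structure LinkDiagram (X : Ambient) where
  /-- Darts, i.e. edge ends, pointing away from their vertex. -/
  Dart : Type
  finite : Finite Dart
  nonempty : Nonempty Dart
  /-- The other end of the same edge. -/
  α : Equiv.Perm Dart
  α_α : ∀ x, α (α x) = x
  α_ne : ∀ x, α x ≠ x
  /-- The next dart at the same vertex, counterclockwise. -/
  σ : Equiv.Perm Dart
  σ_ne : ∀ x, σ x ≠ x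
  /-- With `σ_ne`: every vertex has valency 2 or 4. -/
  σ_four : ∀ x, σ (σ (σ (σ x))) = x
  /-- At a crossing: does the dart belong to the over-strand? (No meaning at bivalent points.) -/
  isOver : Dart → Bool
  isOver_σ : ∀ x, σ (σ x) ≠ x → isOver (σ x) = !isOver x
  /-- `reg x y`: the regions on the left of `x` and on the left of `y` are the same. The region on
  the left of `x` contains the corner from `x` to `σ x`, and it lies on the right of `α x`. -/
  reg : Setoid Dart
  reg_corner : ∀ x, reg (α (σ x)) x
  /-- The surface is connected: any two regions are joined by a path that crosses edges. -/
  connected : ∀ x y, Relation.EqvGen (fun a b => b = α a ∨ reg a b) x y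
  /-- The surface is a sphere: every mod 2 cycle `S` of the graph (a set of edges that has even
  degree at each vertex) separates it, i.e. is the boundary of a union `f` of regions. (Regions are
  spheres with holes; equivalently `V - E - F + 2 * R = 2`, with `F` boundary walks, `R` regions.) -/
  jordan : ∀ S : Dart → ZMod 2, (∀ x, S (α x) = S x) →
    (∀ x, σ (σ x) = x → S x + S (σ x) = 0) →
    (∀ x, σ (σ x) ≠ x → S x + S (σ x) + S (σ (σ x)) + S (σ (σ (σ x))) = 0) →
    ∃ f : Dart → ZMod 2, (∀ x y, reg x y → f x = f y) ∧ ∀ x, f x + f (α x) = S x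
  /-- The region on the left of the dart contains the point at infinity. -/
  outer : Dart → Prop
  outer_spec : match X with
    | .plane => ∃ x, ∀ y, outer y ↔ reg x y
    | .sphere => ∀ y, ¬ outer y

namespace LinkDiagram

/-- The vertex of the dart is a crossing. -/
def IsCrossing {X : Ambient} (D : LinkDiagram X) (x : D.Dart) : Prop := D.σ (D.σ x) ≠ x

/-- Isomorphism of diagrams: an orientation-preserving homeomorphism of the surface (fixing the
point at infinity in the plane case) that carries one diagram, with its vertices, to the other. -/
def Iso {X : Ambient} (D D' : LinkDiagram X) : Prop :=
  ∃ e : D.Dart ≃ D'.Dart,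
    (∀ x, D'.α (e x) = e (D.α x)) ∧
    (∀ x, D'.σ (e x) = e (D.σ x)) ∧
    (∀ x, D.IsCrossing x → D'.isOver (e x) = D.isOver x) ∧
    (∀ x y, D'.reg (e x) (e y) ↔ D.reg x y) ∧
    (∀ x, D'.outer (e x) ↔ D.outer x)

/-- `D'` arises from `D` by placing one more bivalent point, with darts `u` and `v`, on the edge
of the dart `x`. (The regions beside `u` and `v` are determined by `reg_corner`.) -/
def Subdivides {X : Ambient} (D D' : LinkDiagram X) : Prop :=
  ∃ (x : D.Dart) (u v : D'.Dart) (i : D.Dart → D'.Dart),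
    Function.Injective i ∧ u ≠ v ∧ Set.range i = {u, v}ᶜ ∧
    D'.σ u = v ∧ D'.σ v = u ∧
    (∀ z, D'.σ (i z) = i (D.σ z)) ∧
    D'.α (i x) = u ∧ D'.α (i (D.α x)) = v ∧
    (∀ z, z ≠ x → z ≠ D.α x → D'.α (i z) = i (D.α z)) ∧
    (∀ z, D.IsCrossing z → D'.isOver (i z) = D.isOver z) ∧
    (∀ y z, D'.reg (i y) (i z) ↔ D.reg y z) ∧
    (∀ z, D'.outer (i z) ↔ D.outer z)

/-- Equivalence of diagrams, i.e. ambient isotopy in the plane or the sphere. -/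
def Isotopic {X : Ambient} : LinkDiagram X → LinkDiagram X → Prop :=
  Relation.EqvGen (fun D D' => Iso D D' ∨ Subdivides D D')

/-- The classes of `a` and `b` are united. -/
def glue {T : Type} (r : Setoid T) (a b : T) : Setoid T where
  r y z := r y z ∨ ((r y a ∨ r y b) ∧ (r z a ∨ r z b))
  iseqv :=
    { refl := fun y => Or.inl (r.refl y)
      symm := by
        rintro y z (h | ⟨h, k⟩)
        · exact Or.inl (r.symm h)
        · exact Or.inr ⟨k, h⟩
      trans := by
        rintro y z w (h | ⟨h, k⟩) (h' | ⟨h', k'⟩)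
        · exact Or.inl (r.trans h h')
        · exact Or.inr ⟨h'.imp (r.trans h) (r.trans h), k'⟩
        · exact Or.inr ⟨h, k.imp (r.trans (r.symm h')) (r.trans (r.symm h'))⟩
        · exact Or.inr ⟨h, k'⟩ }

open Classical in
theorem smooth_apply {T : Type} (s : Equiv.Perm T) (x z : T) :
    (s * Equiv.swap x (s (s x))) z =
      if z = x then s (s (s x)) else if z = s (s x) then s x else s z := by
  simp only [Equiv.Perm.mul_apply, Equiv.swap_apply_def]
  split_ifs <;> rfl

open Classical in
theorem smooth_even {T : Type} (s : Equiv.Perm T) (hne : ∀ z, s z ≠ z)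
    (hs : ∀ z, s (s (s (s z))) = z) (x : T) (S : T → ZMod 2)
    (h2 : ∀ z, (s * Equiv.swap x (s (s x))) ((s * Equiv.swap x (s (s x))) z) = z →
      S z + S ((s * Equiv.swap x (s (s x))) z) = 0)
    (h4 : ∀ z, (s * Equiv.swap x (s (s x))) ((s * Equiv.swap x (s (s x))) z) ≠ z →
      S z + S ((s * Equiv.swap x (s (s x))) z)
        + S ((s * Equiv.swap x (s (s x))) ((s * Equiv.swap x (s (s x))) z))
        + S ((s * Equiv.swap x (s (s x))) ((s * Equiv.swap x (s (s x)))
          ((s * Equiv.swap x (s (s x))) z))) = 0) :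
    S (s x) = S (s (s x)) ∧ (∀ z, s (s z) = z → S z + S (s z) = 0) ∧
      ∀ z, s (s z) ≠ z → S z + S (s z) + S (s (s z)) + S (s (s (s z))) = 0 := by
  have cancel : ∀ a b : ZMod 2, a + b = 0 → a = b := by decide
  have inj : ∀ a b, s a = s b → a = b := fun a b h => s.injective h
  by_cases hx : s (s x) = x
  · simp only [hx, Equiv.swap_self] at h2 h4
    refine ⟨?_, h2, h4⟩
    have := h2 x hx
    rw [hx]
    exact (cancel _ _ this).symm
  have t0 : (s * Equiv.swap x (s (s x))) x = s (s (s x)) := by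
    rw [smooth_apply, if_pos rfl]
  have t2 : (s * Equiv.swap x (s (s x))) (s (s x)) = s x := by
    rw [smooth_apply, if_neg hx, if_pos rfl]
  have tz : ∀ z, z ≠ x → z ≠ s (s x) → (s * Equiv.swap x (s (s x))) z = s z := fun z h h' => by
    rw [smooth_apply, if_neg h, if_neg h']
  have t1 : (s * Equiv.swap x (s (s x))) (s x) = s (s x) := tz _ (hne x) (fun h => hne _ h.symm)
  have t3 : (s * Equiv.swap x (s (s x))) (s (s (s x))) = x := by
    rw [tz _ (fun h => hne x (by have := hs x; rwa [h] at this)) (hne _), hs]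
  generalize s * Equiv.swap x (s (s x)) = t at *
  have hA : S x = S (s (s (s x))) := by
    have := h2 x (by rw [t0, t3])
    rw [t0] at this
    exact cancel _ _ this
  have hB : S (s x) = S (s (s x)) := by
    have := h2 (s x) (by rw [t1, t2])
    rw [t1] at this
    exact cancel _ _ this
  have e1 : ∀ a b : ZMod 2, a + b + b + a = 0 := by decide
  have e2 : ∀ a b : ZMod 2, a + a + b + b = 0 := by decide
  refine ⟨hB, fun z hz => ?_, fun z hz => ?_⟩
  · have n0 : z ≠ x := fun h => hx (h ▸ hz)
    have n1 : z ≠ s (s x) := fun h => hx (inj _ _ (inj _ _ (h ▸ hz)))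
    have n2 : s z ≠ x := fun h => hx (by rw [← h, hz])
    have n3 : s z ≠ s (s x) := fun h => hx (by
      have h' := inj _ _ h
      rw [h'] at hz
      exact inj _ _ hz)
    have := h2 z (by rw [tz z n0 n1, tz _ n2 n3, hz])
    rwa [tz z n0 n1] at this
  · by_cases hz1 : z = x
    · rw [hz1, hA, hB]; exact e1 _ _
    by_cases hz2 : z = s x
    · rw [hz2, hs, hA, hB]; exact e2 _ _
    by_cases hz3 : z = s (s x)
    · rw [hz3, hs, hA, hB]; exact e1 _ _
    by_cases hz4 : z = s (s (s x))
    · rw [hz4, hs, hA, hB]; exact e2 _ _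
    have n1 : s z ≠ x := fun h => hz4 (by rw [← h, hs])
    have n2 : s z ≠ s (s x) := fun h => hz2 (inj _ _ h)
    have n3 : s (s z) ≠ x := fun h => hz3 (by rw [← h, hs])
    have n4 : s (s z) ≠ s (s x) := fun h => hz1 (inj _ _ (inj _ _ h))
    have := h4 z
    rw [tz z hz1 hz3, tz _ n1 n2, tz _ n3 n4] at this
    exact this hz

open Classical in
/-- Smoothing of the crossing at `x` that opens a channel from the corner between `x` and `σ x` to
the opposite corner. The crossing is replaced by two bivalent points, one with darts `σ x`, `σ² x`
and one with darts `σ³ x`, `x`, and the regions at the two corners are united.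
(If `x` is at a bivalent point, nothing changes.) -/
noncomputable def smooth {X : Ambient} (D : LinkDiagram X) (x : D.Dart) : LinkDiagram X where
  Dart := D.Dart
  finite := D.finite
  nonempty := D.nonempty
  α := D.α
  α_α := D.α_α
  α_ne := D.α_ne
  σ := D.σ * Equiv.swap x (D.σ (D.σ x))
  σ_ne z := by
    have h := D.σ_ne
    have h4 := D.σ_four
    have inj := D.σ.injective
    rw [smooth_apply]
    split_ifs with h1 h2
    · subst h1
      intro h0
      have := h4 z
      rw [h0] at this
      exact h z this
    · subst h2
      exact fun h0 => h _ h0.symm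
    · exact h z
  σ_four z := by
    have h4 := D.σ_four
    have inj : ∀ a b, D.σ a = D.σ b → a = b := fun a b h => D.σ.injective h
    simp only [smooth_apply]
    grind
  isOver := D.isOver
  isOver_σ z := by
    have h4 := D.σ_four
    have ho := D.isOver_σ
    have inj : ∀ a b, D.σ a = D.σ b → a = b := fun a b h => D.σ.injective h
    simp only [smooth_apply]
    grind
  reg := glue D.reg x (D.σ (D.σ x))
  reg_corner z := by
    have hc := D.reg_corner
    have h4 := D.σ_four x
    rw [smooth_apply]
    split_ifs with h1 h2
    · subst h1
      exact Or.inr ⟨Or.inr (hc _), Or.inl (D.reg.refl _)⟩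
    · subst h2
      exact Or.inr ⟨Or.inl (hc _), Or.inr (D.reg.refl _)⟩
    · exact Or.inl (hc z)
  connected y z := by
    refine (D.connected y z).mono ?_
    rintro a b (h | h)
    · exact Or.inl h
    · exact Or.inr (Or.inl h)
  jordan S hα h2 h4 := by
    obtain ⟨hB, g2, g4⟩ := smooth_even D.σ D.σ_ne D.σ_four x S h2 h4
    obtain ⟨f, hf, hfS⟩ := D.jordan S hα g2 g4
    have two : ∀ a b c : ZMod 2, a + b = c → a = b + c := by decide
    have two' : ∀ a b : ZMod 2, a + b + b = a := by decide
    have step : ∀ w, f (D.σ w) = f w + S (D.σ w) := fun w => by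
      rw [← hf _ _ (D.reg_corner w)]
      exact two _ _ _ (hfS (D.σ w))
    have key : f (D.σ (D.σ x)) = f x := by
      rw [step, step, hB, two']
    refine ⟨f, ?_, hfS⟩
    rintro y z (h | ⟨h, k⟩)
    · exact hf _ _ h
    · have e1 : f y = f x := h.elim (fun h => hf _ _ h) (fun h => (hf _ _ h).trans key)
      have e2 : f z = f x := k.elim (fun h => hf _ _ h) (fun h => (hf _ _ h).trans key)
      exact e1.trans e2.symm
  outer y := ∃ z, D.outer z ∧ glue D.reg x (D.σ (D.σ x)) z y
  outer_spec := by
    cases X with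
    | plane =>
      obtain ⟨w, hw⟩ : ∃ w, ∀ y, D.outer y ↔ D.reg w y := D.outer_spec
      refine ⟨w, fun y => ⟨?_, fun h => ⟨w, (hw w).2 (D.reg.refl w), h⟩⟩⟩
      rintro ⟨z, hz, hzy⟩
      exact (glue D.reg x (D.σ (D.σ x))).trans (Or.inl ((hw z).1 hz)) hzy
    | sphere =>
      have h : ∀ y, ¬ D.outer y := D.outer_spec
      rintro y ⟨z, hz, -⟩
      exact h z hz

/-- The corner at `x` is the corner of a monogon: an open disc region, not containing the point at
infinity, bounded by one edge that is a loop at one crossing. -/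
def IsMonogon {X : Ambient} (D : LinkDiagram X) (x : D.Dart) : Prop :=
  D.IsCrossing x ∧ D.α x = D.σ x ∧ (∀ y, D.reg x y → y = x) ∧ ¬ D.outer x

/-- The corners at `x` and `y` are the corners of a special bigon: a disc region, not containing
the point at infinity, bounded by two edges between two different crossings, one of the two edges
lying over the other one at both crossings. -/
def IsSpecialBigon {X : Ambient} (D : LinkDiagram X) (x y : D.Dart) : Prop :=
  D.IsCrossing x ∧ D.IsCrossing y ∧ ¬ D.σ.SameCycle x y ∧
  D.α x = D.σ y ∧ D.α y = D.σ x ∧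
  (∀ z, D.reg x z ↔ z = x ∨ z = y) ∧ ¬ D.outer x ∧
  D.isOver x = D.isOver (D.α x)

/-- The corners at `p`, `q`, `r` are the corners of a triangle to which a Reidemeister move III
applies: a disc region, not containing the point at infinity, bounded by three edges between three
different crossings, such that the strand of the edge from `p` to `q` is over both other strands or
under both other strands. -/
def IsSpecialTriangle {X : Ambient} (D : LinkDiagram X) (p q r : D.Dart) : Prop :=
  D.IsCrossing p ∧ D.IsCrossing q ∧ D.IsCrossing r ∧
  ¬ D.σ.SameCycle p q ∧ ¬ D.σ.SameCycle q r ∧ ¬ D.σ.SameCycle r p ∧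
  D.α p = D.σ q ∧ D.α q = D.σ r ∧ D.α r = D.σ p ∧
  (∀ z, D.reg p z ↔ z = p ∨ z = q ∨ z = r) ∧ ¬ D.outer p ∧
  D.isOver p = D.isOver (D.α p)

/-- The move `RI₋`. Replacing a kink by a simple arc is, up to isotopy, smoothing its crossing so
that the monogon is opened towards the opposite corner: the arc then runs through the old loop in
the reverse direction, without crossing itself. -/
def RI {X : Ambient} (D D' : LinkDiagram X) : Prop :=
  ∃ (E : LinkDiagram X) (x : E.Dart), Isotopic D E ∧ E.IsMonogon x ∧ Isotopic (E.smooth x) D'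

/-- The move `RII₋`. Pulling apart the two strands of a special bigon is, up to isotopy, smoothing
both crossings so that the bigon is opened towards both opposite corners: the strand that leaves
on the left then runs along the left edge of the bigon, and the other one along the right edge. -/
def RII {X : Ambient} (D D' : LinkDiagram X) : Prop :=
  ∃ (E : LinkDiagram X) (x y : E.Dart), Isotopic D E ∧ E.IsSpecialBigon x y ∧
    Isotopic ((E.smooth x).smooth y) D'

open Classical in
/-- For a triangle with corners `p`, `q`, `r`: along each of its three edges `t — α t`, exchange the
end of the edge at one crossing with the end of the strand that leaves the triangle at the other
crossing. This reverses the order in which each strand meets the other two. -/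
noncomputable def flipDart {X : Ambient} (D : LinkDiagram X) (p q r : D.Dart) :
    Equiv.Perm D.Dart :=
  let s := fun t => Equiv.swap (D.σ (D.σ t)) (D.α t) * Equiv.swap (D.σ (D.σ (D.α t))) t
  s p * s q * s r

open Classical in
/-- After a move III on the triangle with corners `p`, `q`, `r`, a dart has on its left the region
that was on the left of this dart. Outside the triangle nothing changes; each of the three edges of
the triangle has the new triangle on one side, and on the other side the region that met the old
triangle only in the opposite corner. -/
noncomputable def flipRegion {X : Ambient} (D : LinkDiagram X) (p q r : D.Dart) (z : D.Dart) :
    D.Dart :=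
  if z = p then D.σ (D.σ r)
  else if z = q then D.σ (D.σ p)
  else if z = r then D.σ (D.σ q)
  else if z = D.α p ∨ z = D.α q ∨ z = D.α r then p
  else z

/-- `D'` arises from `D` by a Reidemeister move III (of any kind) on a triangle. -/
def RIII {X : Ambient} (D D' : LinkDiagram X) : Prop :=
  ∃ (E E' : LinkDiagram X) (p q r : E.Dart) (e : E.Dart ≃ E'.Dart),
    Isotopic D E ∧ E.IsSpecialTriangle p q r ∧
    (∀ z, E'.α (e z) = e (E.α z)) ∧
    (∀ z, E'.σ (e z) = e (E.flipDart p q r (E.σ (E.flipDart p q r z)))) ∧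
    (∀ z, E.IsCrossing (E.flipDart p q r z) → E'.isOver (e z) = E.isOver (E.flipDart p q r z)) ∧
    (∀ y z, E'.reg (e y) (e z) ↔ E.reg (E.flipRegion p q r y) (E.flipRegion p q r z)) ∧
    (∀ z, E'.outer (e z) ↔ E.outer (E.flipRegion p q r z)) ∧
    Isotopic E' D'

/-- `D` and `D'` are diagrams of the same link: they are related by isotopies and Reidemeister
moves I, II, III in either direction. -/
def SameLink {X : Ambient} : LinkDiagram X → LinkDiagram X → Prop :=
  Relation.EqvGen (fun D D' => Isotopic D D' ∨ RI D D' ∨ RII D D' ∨ RIII D D')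

open Classical in
/-- The dart by which a strand leaves the vertex at which it arrives along the edge of `x`. -/
noncomputable def opposite {X : Ambient} (D : LinkDiagram X) (x : D.Dart) : D.Dart :=
  if D.IsCrossing x then D.σ (D.σ x) else D.σ x

/-- The darts on the link component through `x`. -/
def component {X : Ambient} (D : LinkDiagram X) (x : D.Dart) : Set D.Dart :=
  {y | Relation.EqvGen (fun a b => b = D.α a ∨ b = D.opposite a) x y}

/-- The link has an unknotted component that is split from the (nonempty) rest of the link: it has
a diagram in which some component has no crossing and is not the only component. -/
def HasSplitUnknotComponent {X : Ambient} (D : LinkDiagram X) : Prop :=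
  ∃ D' : LinkDiagram X, SameLink D D' ∧
    ∃ x, (∀ y ∈ D'.component x, ¬ D'.IsCrossing y) ∧ ∃ z, z ∉ D'.component x

/-- One move `RI₋` or `RII₋`. -/
def Reduces {X : Ambient} (D D' : LinkDiagram X) : Prop := RI D D' ∨ RII D D'

/-- No move `RI₋` or `RII₋` can be applied. -/
def IsMinimal {X : Ambient} (D : LinkDiagram X) : Prop := ∀ D', ¬ Reduces D D'

end LinkDiagram

/-!
Forgetting bivalent points, opening monogons and opening special bigons are simplifications of
diagrams; they terminate, and they commute with isomorphisms. By Newman's lemma it is enough that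
two simplifications of one diagram can be joined. This is clear if they happen at different
vertices. If two faces to be opened share a crossing, they lie in opposite or in neighbouring
corners there. Smoothing a crossing between opposite corners merges the two faces into a monogon or
into a bigon whose strands alternate at its corners, and an alternating bigon gives the same diagram
whichever of its two corners is smoothed. Two special bigons in neighbouring corners would exhibit a
split unknot.
-/

section Rewriting

open Relation

variable {α : Type*} {r s : α → α → Prop} {p : α → Prop} {a b c : α}

/-- A terminating rewriting relation `r`, considered modulo the equivalence relation `s`, that is
locally confluent on a class `p` of objects closed under conversion. The relation `s` is required to
be a bisimulation for `r`, so that `s`-steps can be postponed. -/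
structure IsLocallyConfluentModulo (r s : α → α → Prop) (p : α → Prop) : Prop where
  equivalence : Equivalence s
  bisimulation : ∀ ⦃a a' b⦄, s a a' → r a b → ∃ b', r a' b' ∧ s b b'
  wellFounded : WellFounded (Function.swap r)
  invariant : ∀ ⦃a b⦄, (r ⊔ s) a b → (p a ↔ p b)
  join_of_rel : ∀ ⦃a b c⦄, p a → r a b → r a c → Join (ReflTransGen (r ⊔ s)) b c

namespace IsLocallyConfluentModulo

theorem rel_or_exists_rel (h : IsLocallyConfluentModulo r s p) (hab : ReflTransGen (r ⊔ s) a b) :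
    s a b ∨ ∃ c, r a c ∧ ReflTransGen (r ⊔ s) c b := by
  induction hab using ReflTransGen.head_induction_on with
  | refl => exact .inl (h.equivalence.refl b)
  | head hac hcb ih =>
    rcases hac with hac | hac
    · exact .inr ⟨_, hac, hcb⟩
    · rcases ih with ih | ⟨d, hcd, hdb⟩
      · exact .inl (h.equivalence.trans hac ih)
      · obtain ⟨d', had', hdd'⟩ := h.bisimulation (h.equivalence.symm hac) hcd
        exact .inr ⟨d', had', .head (.inr (h.equivalence.symm hdd')) hdb⟩

theorem join_of_reflTransGen (h : IsLocallyConfluentModulo r s p) (ha : p a)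
    (hab : ReflTransGen (r ⊔ s) a b) (hac : ReflTransGen (r ⊔ s) a c) :
    Join (ReflTransGen (r ⊔ s)) b c := by
  induction a using h.wellFounded.induction generalizing b c with
  | _ a ih =>
  rcases h.rel_or_exists_rel hab with hsab | ⟨b', hab', hb'b⟩
  · exact ⟨c, .head (.inr (h.equivalence.symm hsab)) hac, .refl⟩
  rcases h.rel_or_exists_rel hac with hsac | ⟨c', hac', hc'c⟩
  · exact ⟨b, .refl, .head (.inr (h.equivalence.symm hsac)) hab⟩
  obtain ⟨d, hb'd, hc'd⟩ := h.join_of_rel ha hab' hac'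
  obtain ⟨e, hbe, hde⟩ := ih b' hab' ((h.invariant (.inl hab')).1 ha) hb'b hb'd
  obtain ⟨f, hcf, hef⟩ := ih c' hac' ((h.invariant (.inl hac')).1 ha) hc'c (hc'd.trans hde)
  exact ⟨f, hbe.trans hef, hcf⟩

theorem join_of_eqvGen (h : IsLocallyConfluentModulo r s p) (ha : p a)
    (hab : EqvGen (r ⊔ s) a b) : Join (ReflTransGen (r ⊔ s)) a b := by
  suffices hp : (p a ↔ p b) ∧ (p a → Join (ReflTransGen (r ⊔ s)) a b) from hp.2 ha
  clear ha
  induction hab with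
  | rel a b hab => exact ⟨h.invariant hab, fun _ => ⟨b, .single hab, .refl⟩⟩
  | refl a => exact ⟨Iff.rfl, fun _ => ⟨a, .refl, .refl⟩⟩
  | symm a b _ ih => exact ⟨ih.1.symm, fun hb => (ih.2 (ih.1.2 hb)).imp fun _ => And.symm⟩
  | trans a b c _ _ ih ih' =>
    refine ⟨ih.1.trans ih'.1, fun ha => ?_⟩
    obtain ⟨d, had, hbd⟩ := ih.2 ha
    obtain ⟨e, hbe, hce⟩ := ih'.2 (ih.1.1 ha)
    obtain ⟨f, hdf, hef⟩ := h.join_of_reflTransGen (ih.1.1 ha) hbd hbe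
    exact ⟨f, had.trans hdf, hce.trans hef⟩

end IsLocallyConfluentModulo

end Rewriting

namespace LinkDiagram

variable {X : Ambient} {A B C : LinkDiagram X}

theorem sameCycle_iff (A : LinkDiagram X) (x y : A.Dart) : A.σ.SameCycle x y ↔
    y = x ∨ y = A.σ x ∨ y = A.σ (A.σ x) ∨ y = A.σ (A.σ (A.σ x)) := by
  constructor
  · rintro ⟨n, rfl⟩
    rw [zpow_eq_zpow_emod' n (show A.σ ^ 4 = 1 from Equiv.ext A.σ_four)]
    have h0 : 0 ≤ n % (4 : ℕ) := Int.emod_nonneg n (by norm_num)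
    have h4 : n % (4 : ℕ) < 4 := Int.emod_lt_of_pos n (by norm_num)
    generalize n % (4 : ℕ) = m at h0 h4
    interval_cases m
    exacts [.inl rfl, .inr (.inl rfl), .inr (.inr (.inl rfl)), .inr (.inr (.inr rfl))]
  · rintro (h | h | h | h)
    exacts [⟨0, h.symm⟩, ⟨1, h.symm⟩, ⟨2, h.symm⟩, ⟨3, h.symm⟩]

/-- The bijection of darts is an isomorphism of diagrams. -/
structure IsIso (e : A.Dart ≃ B.Dart) : Prop where
  α : ∀ x, B.α (e x) = e (A.α x)
  σ : ∀ x, B.σ (e x) = e (A.σ x)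
  isOver : ∀ x, A.IsCrossing x → B.isOver (e x) = A.isOver x
  reg : ∀ x y, B.reg (e x) (e y) ↔ A.reg x y
  outer : ∀ x, B.outer (e x) ↔ A.outer x

theorem iso_iff : Iso A B ↔ ∃ e : A.Dart ≃ B.Dart, IsIso e :=
  ⟨fun ⟨e, h1, h2, h3, h4, h5⟩ => ⟨e, h1, h2, h3, h4, h5⟩,
    fun ⟨e, h⟩ => ⟨e, h.α, h.σ, h.isOver, h.reg, h.outer⟩⟩

namespace IsIso

variable {e : A.Dart ≃ B.Dart} {f : B.Dart ≃ C.Dart}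

theorem iso (h : IsIso e) : Iso A B := iso_iff.2 ⟨e, h⟩

theorem refl (A : LinkDiagram X) : IsIso (Equiv.refl A.Dart) :=
  ⟨fun _ => rfl, fun _ => rfl, fun _ _ => rfl, fun _ _ => Iff.rfl, fun _ => Iff.rfl⟩

theorem isCrossing_iff (h : IsIso e) (x : A.Dart) : B.IsCrossing (e x) ↔ A.IsCrossing x := by
  simp only [IsCrossing, h.σ, ne_eq, e.apply_eq_iff_eq]

theorem symm (h : IsIso e) : IsIso e.symm where
  α x := by rw [Equiv.eq_symm_apply, ← h.α, e.apply_symm_apply]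
  σ x := by rw [Equiv.eq_symm_apply, ← h.σ, e.apply_symm_apply]
  isOver x hx := by
    rw [← e.apply_symm_apply x, h.isCrossing_iff] at hx
    rw [← h.isOver _ hx, e.apply_symm_apply]
  reg x y := by rw [← h.reg, e.apply_symm_apply, e.apply_symm_apply]
  outer x := by rw [← h.outer, e.apply_symm_apply]

theorem trans (h : IsIso e) (h' : IsIso f) : IsIso (e.trans f) where
  α x := by simp only [Equiv.trans_apply, h.α, h'.α]
  σ x := by simp only [Equiv.trans_apply, h.σ, h'.σ]
  isOver x hx := by
    rw [Equiv.trans_apply, h'.isOver _ ((h.isCrossing_iff x).2 hx), h.isOver x hx]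
  reg x y := by simp only [Equiv.trans_apply, h.reg, h'.reg]
  outer x := by simp only [Equiv.trans_apply, h.outer, h'.outer]

theorem sameCycle_iff (h : IsIso e) (x y : A.Dart) :
    B.σ.SameCycle (e x) (e y) ↔ A.σ.SameCycle x y := by
  simp only [LinkDiagram.sameCycle_iff, h.σ, e.apply_eq_iff_eq]

end IsIso

theorem iso_equivalence : Equivalence (Iso (X := X)) where
  refl A := (IsIso.refl A).iso
  symm h := by
    obtain ⟨e, h⟩ := iso_iff.1 h
    exact h.symm.iso
  trans h h' := by
    obtain ⟨e, h⟩ := iso_iff.1 h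
    obtain ⟨f, h'⟩ := iso_iff.1 h'
    exact (h.trans h').iso

end LinkDiagram

section Bypass

variable {T T' : Type*} {a : T → T} {u v w t z : T}

open Classical in
/-- For an involution `a`, thought of as the pairing of the ends of the edges of a graph: the
element `z` itself, or, if `z` is one of the ends `u`, `v` at a bivalent point, the end that one
meets when continuing from `z` through that point. -/
noncomputable def slide (a : T → T) (u v z : T) : T :=
  if z = u then a v else if z = v then a u else z

/-- The pairing of edge ends once the bivalent point with ends `u` and `v` has been forgotten. -/
noncomputable def bypass (a : T → T) (u v z : T) : T := slide a u v (a z)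

theorem slide_of_ne (hu : z ≠ u) (hv : z ≠ v) : slide a u v z = z := by
  rw [slide, if_neg hu, if_neg hv]

theorem slide_ne (ha : ∀ x, a x ≠ x) (huv : a u ≠ v) (hvu : a v ≠ u) :
    slide a u v z ≠ u ∧ slide a u v z ≠ v := by
  grind [slide]

theorem slide_apply (ha : a.Involutive) (hne : ∀ x, a x ≠ x) (huv : u ≠ v) :
    slide a u v (a z) = bypass a u v (slide a u v z) := by
  grind [slide, bypass, ha.eq_iff]

theorem bypass_ne_self (ha : a.Involutive) (hne : ∀ x, a x ≠ x) (huv : u ≠ v) :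
    bypass a u v z ≠ z := by
  grind [slide, bypass, ha.eq_iff]

theorem bypass_bypass (ha : a.Involutive) (huv : u ≠ v) (hu : z ≠ u) (hv : z ≠ v) :
    bypass a u v (bypass a u v z) = z := by
  grind [slide, bypass, ha.eq_iff]

theorem bypass_ne_symm (ha : a.Involutive) (huv : a u ≠ v)
    (h : bypass a u v w ≠ t) : bypass a w t u ≠ v := by
  grind [slide, bypass, ha.eq_iff]

theorem bypass_comm (ha : a.Involutive) (huv : u ≠ v) (hwt : w ≠ t)
    (hwu : w ≠ u) (hwv : w ≠ v) (htu : t ≠ u) (htv : t ≠ v)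
    (h : bypass a u v w ≠ t) (hzu : z ≠ u) (hzv : z ≠ v) (hzw : z ≠ w) :
    bypass (bypass a u v) w t z = bypass (bypass a w t) u v z := by
  grind [slide, bypass, ha.eq_iff]

theorem map_bypass {b : T' → T'} {f : T → T'} (hf : f.Injective) (hab : ∀ x, f (a x) = b (f x)) :
    f (bypass a u v z) = bypass b (f u) (f v) (f z) := by
  classical
  simp only [bypass, slide, ← hab, hf.eq_iff, apply_ite f]

end Bypass

namespace LinkDiagram

variable {X : Ambient} {A : LinkDiagram X}

/-- The bivalent point at `u` is not the only vertex on its closed curve. -/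
def Removable (A : LinkDiagram X) (u : A.Dart) : Prop := A.σ (A.σ u) = u ∧ A.α u ≠ A.σ u

section Delete

variable {u : A.Dart}

/-- The darts of the diagram without the bivalent point at `u`. -/
abbrev Rest (A : LinkDiagram X) (u : A.Dart) : Type := {z : A.Dart // z ≠ u ∧ z ≠ A.σ u}

namespace Removable

theorem ne_iff (h : A.Removable u) (z : A.Dart) :
    A.σ z ≠ u ∧ A.σ z ≠ A.σ u ↔ z ≠ u ∧ z ≠ A.σ u := by
  grind [Removable, A.σ.injective.eq_iff]

/-- A dart beside the same region as `z` that does not belong to the bivalent point at `u`. -/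
noncomputable def retract (h : A.Removable u) (z : A.Dart) : A.Rest u :=
  ⟨slide A.α u (A.σ u) z, slide_ne A.α_ne h.2 fun h0 => h.2 (by rw [← A.α_α (A.σ u), h0])⟩

/-- The pairing of edge ends in the diagram without the bivalent point at `u`. -/
noncomputable def restα (h : A.Removable u) : Equiv.Perm (A.Rest u) :=
  Function.Involutive.toPerm (fun z => h.retract (A.α z)) fun z =>
    Subtype.ext (bypass_bypass A.α_α (A.σ_ne u).symm z.2.1 z.2.2)

/-- The cyclic order at the vertices of the diagram without the bivalent point at `u`. -/
def restσ (h : A.Removable u) : Equiv.Perm (A.Rest u) := A.σ.subtypePerm h.ne_iff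

theorem retract_coe (h : A.Removable u) (z : A.Rest u) : h.retract z = z :=
  Subtype.ext (slide_of_ne z.2.1 z.2.2)

theorem retract_α (h : A.Removable u) (z : A.Dart) :
    h.retract (A.α z) = h.restα (h.retract z) :=
  Subtype.ext (slide_apply A.α_α A.α_ne (A.σ_ne u).symm)

theorem reg_retract (h : A.Removable u) (z : A.Dart) : A.reg (h.retract z) z := by
  have hu := A.reg_corner (A.σ u)
  rw [h.1] at hu
  unfold retract slide
  split_ifs with e1 e2
  · exact e1 ▸ A.reg_corner u
  · exact e2 ▸ hu
  · exact A.reg.refl z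

theorem connected (h : A.Removable u) (y z : A.Rest u) :
    Relation.EqvGen (fun a b : A.Rest u => b = h.restα a ∨ A.reg a b) y z := by
  rw [← h.retract_coe y, ← h.retract_coe z]
  refine Setoid.eqvGen_le (s := (Relation.EqvGen.setoid _).comap (h.retract)) ?_
    (A.connected y z)
  rintro a b (rfl | hab)
  · exact .rel _ _ (.inl (h.retract_α a))
  · exact .rel _ _ (.inr (A.reg.trans (h.reg_retract a)
      (A.reg.trans hab (A.reg.symm (h.reg_retract b)))))

theorem jordan (h : A.Removable u) (S : A.Rest u → ZMod 2)
    (hα : ∀ z, S (h.restα z) = S z)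
    (h2 : ∀ z, h.restσ (h.restσ z) = z → S z + S (h.restσ z) = 0)
    (h4 : ∀ z, h.restσ (h.restσ z) ≠ z → S z + S (h.restσ z) +
      S (h.restσ (h.restσ z)) + S (h.restσ (h.restσ (h.restσ z))) = 0) :
    ∃ f : A.Rest u → ZMod 2, (∀ y z : A.Rest u, A.reg y z → f y = f z) ∧
      ∀ z, f z + f (h.restα z) = S z := by
  have hu : S (h.retract (A.σ u)) = S (h.retract u) := by
    have : h.retract (A.α u) = h.retract (A.σ u) :=
      Subtype.ext (by grind [retract, slide, A.α_ne, A.σ_ne, h.2])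
    rw [← this, h.retract_α, hα]
  have hcoe (z : A.Dart) (hz : z ≠ u ∧ z ≠ A.σ u) : ∃ w : A.Rest u, w = z := ⟨⟨z, hz⟩, rfl⟩
  have hσ (z : A.Rest u) : A.σ z = h.restσ z := rfl
  have hS2 (z : A.Dart) (hz : A.σ (A.σ z) = z) :
      S (h.retract z) + S (h.retract (A.σ z)) = 0 := by
    by_cases hzu : z ≠ u ∧ z ≠ A.σ u
    · obtain ⟨z, rfl⟩ := hcoe z hzu
      simpa only [hσ, h.retract_coe] using h2 z (Subtype.ext hz)
    · obtain rfl | rfl : z = u ∨ z = A.σ u := by tauto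
      · rw [hu, CharTwo.add_self_eq_zero]
      · rw [h.1, hu, CharTwo.add_self_eq_zero]
  have hS4 (z : A.Dart) (hz : A.σ (A.σ z) ≠ z) : S (h.retract z) + S (h.retract (A.σ z)) +
      S (h.retract (A.σ (A.σ z))) + S (h.retract (A.σ (A.σ (A.σ z)))) = 0 := by
    obtain ⟨z, rfl⟩ := hcoe z (by grind [Removable])
    simpa only [hσ, h.retract_coe] using h4 z fun h0 => hz (congrArg Subtype.val h0)
  obtain ⟨f, hf, hfS⟩ := A.jordan (fun z => S (h.retract z))
    (fun z => by rw [h.retract_α, hα]) hS2 hS4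
  refine ⟨fun z => f z, fun y z => hf y z, fun z => ?_⟩
  exact (congrArg _ (hf _ _ (h.reg_retract (A.α z)))).trans
    ((hfS z).trans (congrArg S (h.retract_coe z)))

/-- The diagram without the bivalent point at `u`. -/
noncomputable def delete (h : A.Removable u) : LinkDiagram X where
  Dart := A.Rest u
  finite := have := A.finite; inferInstance
  nonempty := A.nonempty.map (h.retract)
  α := h.restα
  α_α z := Subtype.ext (bypass_bypass A.α_α (A.σ_ne u).symm z.2.1 z.2.2)
  α_ne z hz := bypass_ne_self A.α_α A.α_ne (A.σ_ne u).symm (congrArg Subtype.val hz)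
  σ := h.restσ
  σ_ne z hz := A.σ_ne z (congrArg Subtype.val hz)
  σ_four z := Subtype.ext (A.σ_four z)
  isOver z := A.isOver z
  isOver_σ z hz := A.isOver_σ z fun h0 => hz (Subtype.ext h0)
  reg := A.reg.comap Subtype.val
  reg_corner z := A.reg.trans (h.reg_retract _) (A.reg_corner z)
  connected := h.connected
  jordan := h.jordan
  outer z := A.outer z
  outer_spec := by
    cases X with
    | plane =>
      obtain ⟨w, hw⟩ : ∃ w, ∀ y, A.outer y ↔ A.reg w y := A.outer_spec
      exact ⟨h.retract w, fun y => (hw y).trans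
        ⟨A.reg.trans (h.reg_retract w), A.reg.trans (A.reg.symm (h.reg_retract w))⟩⟩
    | sphere => exact fun y => A.outer_spec y

theorem coe_delete_α (h : A.Removable u) (z : (h.delete).Dart) :
    ((h.delete).α z).1 = bypass A.α u (A.σ u) z.1 := rfl

end Removable

end Delete

section Subdivision

variable {B : LinkDiagram X}

theorem Removable.subdivides_delete {u : A.Dart} (h : A.Removable u) : Subdivides h.delete A := by
  let x : h.delete.Dart := ⟨A.α u, A.α_ne u, h.2⟩
  have hx : (h.delete.α x).1 = A.α (A.σ u) := by
    rw [h.coe_delete_α, bypass, A.α_α, slide, if_pos rfl]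
  refine ⟨x, u, A.σ u, Subtype.val, Subtype.val_injective, (A.σ_ne u).symm, ?_, rfl, h.1,
    fun z => rfl, A.α_α u, by rw [hx, A.α_α], fun z hz hz' => ?_, fun _ _ => rfl,
    fun _ _ => Iff.rfl, fun _ => Iff.rfl⟩
  · exact Subtype.range_coe.trans (Set.ext fun z => not_or.symm)
  · have hzu : A.α z.1 ≠ u := fun h0 => hz (Subtype.ext (h0 ▸ A.α_α z.1).symm)
    have hzσu : A.α z.1 ≠ A.σ u := fun h0 =>
      hz' (Subtype.ext ((A.α_α z.1).symm.trans ((congrArg A.α h0).trans hx.symm)))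
    rw [h.coe_delete_α, bypass, slide_of_ne hzu hzσu]

theorem Subdivides.exists_delete (h : Subdivides B A) :
    ∃ (u : A.Dart) (hu : A.Removable u), Iso B hu.delete := by
  obtain ⟨x, u, v, i, hi, huv, hr, rfl, hv, hσ, hx, hx', hα, ho, hreg, hout⟩ := h
  have hne (z : B.Dart) : i z ≠ u ∧ i z ≠ A.σ u := by
    have hz : i z ∈ ({u, A.σ u} : Set A.Dart)ᶜ := hr ▸ Set.mem_range_self z
    simpa using hz
  have hu : A.Removable u := ⟨hv, by rw [← congrArg A.α hx, A.α_α]; exact (hne x).2⟩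
  have hbij : Function.Bijective fun z => (⟨i z, hne z⟩ : A.Rest u) := by
    refine ⟨fun a b hab => hi (congrArg Subtype.val hab), fun ⟨z, hz⟩ => ?_⟩
    obtain ⟨w, rfl⟩ : z ∈ Set.range i := by rw [hr]; simpa using hz
    exact ⟨w, rfl⟩
  refine ⟨u, hu, Equiv.ofBijective _ hbij, fun z => Subtype.ext ?_, fun z => Subtype.ext (hσ z),
    ho, hreg, hout⟩
  change bypass A.α u (A.σ u) (i z) = i (B.α z)
  by_cases hzx : z = x
  · rw [hzx, bypass, hx, slide, if_pos rfl, ← hx', A.α_α]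
  by_cases hzx' : z = B.α x
  · rw [hzx', bypass, hx', slide, if_neg huv.symm, if_pos rfl, ← hx, A.α_α, B.α_α]
  · rw [bypass, hα z hzx hzx', slide_of_ne (hne _).1 (hne _).2]

theorem Iso.isotopic (h : Iso A B) : Isotopic A B := .rel _ _ (.inl h)

theorem Removable.isotopic_delete {u : A.Dart} (h : A.Removable u) : Isotopic A h.delete :=
  .symm _ _ (.rel _ _ (.inr h.subdivides_delete))

theorem IsIso.removable {e : A.Dart ≃ B.Dart} (h : IsIso e) {u : A.Dart} (hu : A.Removable u) :
    B.Removable (e u) := by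
  simpa only [Removable, h.α, h.σ, ne_eq, e.apply_eq_iff_eq] using hu

theorem IsIso.delete {e : A.Dart ≃ B.Dart} (h : IsIso e) {u : A.Dart} (hu : A.Removable u) :
    Iso hu.delete (h.removable hu).delete := by
  refine ⟨e.subtypeEquiv fun z => ?_, fun z => Subtype.ext ?_, fun z => Subtype.ext (h.σ z.1),
    fun z hz => h.isOver z.1 fun h0 => hz (Subtype.ext h0), fun y z => h.reg y.1 z.1,
    fun z => h.outer z.1⟩
  · simp only [h.σ, ne_eq, e.apply_eq_iff_eq]
  · have hα : e (bypass A.α u (A.σ u) z.1) = bypass B.α (e u) (B.σ (e u)) (e z.1) := by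
      rw [h.σ, map_bypass e.injective fun x => (h.α x).symm]
    exact hα.symm

end Subdivision

section Smoothing

theorem outer_iff_of_reg {x y : A.Dart} (h : A.reg x y) : A.outer x ↔ A.outer y := by
  cases X with
  | plane =>
    obtain ⟨w, hw⟩ : ∃ w, ∀ y, A.outer y ↔ A.reg w y := A.outer_spec
    rw [hw, hw]
    exact ⟨fun hx => A.reg.trans hx h, fun hy => A.reg.trans hy (A.reg.symm h)⟩
  | sphere => exact iff_of_false (A.outer_spec x) (A.outer_spec y)

theorem glue_le_iff {T : Type} {r s : Setoid T} {a b : T} : glue r a b ≤ s ↔ r ≤ s ∧ s a b := by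
  refine ⟨fun h => ⟨fun _ _ h' => h (.inl h'), h (.inr ⟨.inl (r.refl a), .inr (r.refl b)⟩)⟩, ?_⟩
  rintro ⟨hr, hab⟩ y z (h | ⟨hy, hz⟩)
  · exact hr h
  · have key {t : T} (ht : r t a ∨ r t b) : s t a :=
      ht.elim (fun h => hr h) fun h => s.trans (hr h) (s.symm hab)
    exact s.trans (key hy) (s.symm (key hz))

theorem glue_comm {T : Type} (r : Setoid T) (a b c d : T) :
    glue (glue r a b) c d = glue (glue r c d) a b :=
  eq_of_forall_ge_iff fun s => by simp only [glue_le_iff, and_right_comm]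

theorem glue_swap {T : Type} (r : Setoid T) (a b : T) : glue r a b = glue r b a :=
  eq_of_forall_ge_iff fun s => by
    rw [glue_le_iff, glue_le_iff]
    exact and_congr_right fun _ => ⟨s.symm, s.symm⟩

theorem IsCrossing.next {x : A.Dart} (hx : A.IsCrossing x) : A.IsCrossing (A.σ x) :=
  fun h => hx (A.σ.injective h)

variable {x y z : A.Dart}

open Classical in
theorem smooth_σ (A : LinkDiagram X) (x z : A.Dart) : (A.smooth x).σ z =
    if z = x then A.σ (A.σ (A.σ x)) else if z = A.σ (A.σ x) then A.σ x else A.σ z :=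
  smooth_apply A.σ x z

theorem smooth_σ_self (A : LinkDiagram X) (x : A.Dart) :
    (A.smooth x).σ x = A.σ (A.σ (A.σ x)) := by
  rw [smooth_σ, if_pos rfl]

theorem smooth_σ_next (A : LinkDiagram X) (x : A.Dart) :
    (A.smooth x).σ (A.σ x) = A.σ (A.σ x) := by
  grind [smooth_σ, A.σ_ne]

theorem smooth_σ_opposite (A : LinkDiagram X) (x : A.Dart) :
    (A.smooth x).σ (A.σ (A.σ x)) = A.σ x := by
  grind [smooth_σ, A.σ_four]

theorem smooth_σ_prev (A : LinkDiagram X) (x : A.Dart) :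
    (A.smooth x).σ (A.σ (A.σ (A.σ x))) = x := by
  grind [smooth_σ, A.σ_four, A.σ_ne]

theorem smooth_σ_of_not_sameCycle (h : ¬ A.σ.SameCycle x z) : (A.smooth x).σ z = A.σ z := by
  grind [smooth_σ, LinkDiagram.sameCycle_iff]

theorem smooth_σ_of_not_isCrossing (h : ¬ A.IsCrossing z) (x : A.Dart) :
    (A.smooth x).σ z = A.σ z := by
  grind [smooth_σ, IsCrossing, A.σ_four]

theorem IsCrossing.of_smooth (h : (A.smooth x).IsCrossing z) : A.IsCrossing z := by
  by_contra hz
  refine h ?_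
  rw [smooth_σ_of_not_isCrossing hz, smooth_σ_of_not_isCrossing fun h' => hz fun h => h' ?_]
  · exact not_not.1 hz
  · rw [h]

theorem IsCrossing.smooth (hz : A.IsCrossing z) (h : ¬ A.σ.SameCycle x z) :
    (A.smooth x).IsCrossing z := by
  unfold IsCrossing
  rwa [smooth_σ_of_not_sameCycle h,
    smooth_σ_of_not_sameCycle (by rwa [Equiv.Perm.sameCycle_apply_right])]

theorem not_isCrossing_smooth (A : LinkDiagram X) (x : A.Dart) : ¬ (A.smooth x).IsCrossing x :=
  fun h => h (by rw [smooth_σ_self, smooth_σ_prev])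

theorem sameCycle_of_smooth (h : (A.smooth x).σ.SameCycle y z) : A.σ.SameCycle y z := by
  have h := ((A.smooth x).sameCycle_iff y z).1 h
  rw [LinkDiagram.sameCycle_iff]
  grind [smooth_σ, A.σ_four, A.σ.injective.eq_iff]

theorem IsIso.smooth {B : LinkDiagram X} {e : A.Dart ≃ B.Dart} (h : IsIso e) (x : A.Dart) :
    IsIso (A := A.smooth x) (B := B.smooth (e x)) e := by
  have hσ (z : A.Dart) : (B.smooth (e x)).σ (e z) = e ((A.smooth x).σ z) := by
    rw [smooth_σ, smooth_σ]
    grind [h.σ, e.apply_eq_iff_eq]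
  have hreg (y z : A.Dart) : (B.smooth (e x)).reg (e y) (e z) ↔ (A.smooth x).reg y z := by
    change (_ ∨ _) ↔ (_ ∨ _)
    simp only [h.σ, h.reg]
  refine ⟨h.α, hσ, fun z hz => h.isOver z hz.of_smooth, hreg, fun z => ⟨?_, ?_⟩⟩
  · rintro ⟨w, hw, hwz⟩
    obtain ⟨w, rfl⟩ := e.surjective w
    exact ⟨w, (h.outer w).1 hw, (hreg w z).1 hwz⟩
  · rintro ⟨w, hw, hwz⟩
    exact ⟨e w, (h.outer w).2 hw, (hreg w z).2 hwz⟩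

theorem smooth_smooth_outer_iff (A : LinkDiagram X) (x y z : A.Dart) :
    ((A.smooth x).smooth y).outer z ↔ ∃ w, A.outer w ∧ ((A.smooth x).smooth y).reg w z := by
  constructor
  · rintro ⟨w, ⟨v, hv, hvw⟩, hwz⟩
    exact ⟨v, hv, ((A.smooth x).smooth y).reg.trans (Or.inl hvw) hwz⟩
  · rintro ⟨w, hw, hwz⟩
    exact ⟨w, ⟨w, hw, (A.smooth x).reg.refl w⟩, hwz⟩

theorem smooth_opposite_isIso (A : LinkDiagram X) (x : A.Dart) :
    IsIso (A := A.smooth (A.σ (A.σ x))) (B := A.smooth x) (Equiv.refl A.Dart) := by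
  have hreg : (A.smooth x).reg = (A.smooth (A.σ (A.σ x))).reg := by
    change glue A.reg _ _ = glue A.reg _ _
    rw [A.σ_four, glue_swap]
  refine ⟨fun _ => rfl, fun z => ?_, fun _ _ => rfl, fun y z => ?_, fun z => ?_⟩
  · change (A.smooth x).σ z = (A.smooth (A.σ (A.σ x))).σ z
    grind [smooth_σ, A.σ_four, A.σ.injective.eq_iff]
  · exact iff_of_eq (congrArg (fun r : Setoid A.Dart => r y z) hreg)
  · exact exists_congr fun w => and_congr_right fun _ =>
      iff_of_eq (congrArg (fun r : Setoid A.Dart => r w z) hreg)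

theorem smooth_smooth_comm (h : ¬ A.σ.SameCycle x y) :
    IsIso (A := (A.smooth x).smooth y) (B := (A.smooth y).smooth x) (Equiv.refl A.Dart) := by
  have hy : (A.smooth x).σ ((A.smooth x).σ y) = A.σ (A.σ y) := by
    rw [smooth_σ_of_not_sameCycle h,
      smooth_σ_of_not_sameCycle (by rwa [Equiv.Perm.sameCycle_apply_right])]
  have hx : (A.smooth y).σ ((A.smooth y).σ x) = A.σ (A.σ x) := by
    rw [smooth_σ_of_not_sameCycle fun h' => h h'.symm,
      smooth_σ_of_not_sameCycle fun h' => h (Equiv.Perm.sameCycle_apply_right.1 h').symm]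
  have hreg : ((A.smooth y).smooth x).reg = ((A.smooth x).smooth y).reg := by
    change glue (glue A.reg _ _) _ _ = glue (glue A.reg _ _) _ _
    rw [hx, hy, glue_comm]
  refine ⟨fun _ => rfl, fun z => ?_, fun _ _ => rfl, fun y z => ?_, fun z => ?_⟩
  · change ((A.smooth y).smooth x).σ z = ((A.smooth x).smooth y).σ z
    refine (smooth_σ (A.smooth y) x z).trans (Eq.trans ?_ (smooth_σ (A.smooth x) y z).symm)
    rw [hx, hy]
    rw [LinkDiagram.sameCycle_iff] at h
    grind [smooth_σ, A.σ_four, A.σ.injective.eq_iff]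
  · exact iff_of_eq (congrArg (fun r : Setoid A.Dart => r y z) hreg)
  · refine (smooth_smooth_outer_iff A y x z).trans (Iff.trans ?_
      (smooth_smooth_outer_iff A x y z).symm)
    exact exists_congr fun w => and_congr_right fun _ =>
      iff_of_eq (congrArg (fun r : Setoid A.Dart => r w z) hreg)

theorem smooth_smooth_smooth_comm (hxz : ¬ A.σ.SameCycle x z) (hyz : ¬ A.σ.SameCycle y z) :
    IsIso (A := ((A.smooth x).smooth y).smooth z) (B := ((A.smooth z).smooth x).smooth y)
      (Equiv.refl A.Dart) :=
  (smooth_smooth_comm (A := A.smooth x) fun h => hyz (sameCycle_of_smooth h)).trans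
    ((smooth_smooth_comm hxz).smooth y)

end Smoothing

section Faces

variable {B : LinkDiagram X} {x y z w : A.Dart}

/-- The region at `z` is neither of the two regions that smoothing at `x` unites. -/
def AvoidsChannel (A : LinkDiagram X) (x z : A.Dart) : Prop :=
  ¬ A.reg z x ∧ ¬ A.reg z (A.σ (A.σ x))

theorem AvoidsChannel.smooth_reg_iff (h : A.AvoidsChannel x z) (w : A.Dart) :
    (A.smooth x).reg z w ↔ A.reg z w :=
  ⟨fun h' => h'.resolve_right fun ⟨h', _⟩ => h'.elim h.1 h.2, Or.inl⟩

theorem AvoidsChannel.smooth_outer_iff (h : A.AvoidsChannel x z) :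
    (A.smooth x).outer z ↔ A.outer z := by
  refine ⟨?_, fun hz => ⟨z, hz, (A.smooth x).reg.refl z⟩⟩
  rintro ⟨w, hw, hwz⟩
  exact (outer_iff_of_reg ((h.smooth_reg_iff w).1 ((A.smooth x).reg.symm hwz))).2 hw

/-- The corners at `x` and `y` are the corners of a bigon between two different crossings: a special
bigon without the condition on over- and under-strands. -/
structure IsBigon (A : LinkDiagram X) (x y : A.Dart) : Prop where
  isCrossing_left : A.IsCrossing x
  isCrossing_right : A.IsCrossing y
  not_sameCycle : ¬ A.σ.SameCycle x y
  α_left : A.α x = A.σ y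
  α_right : A.α y = A.σ x
  reg_iff : ∀ z, A.reg x z ↔ z = x ∨ z = y
  not_outer : ¬ A.outer x

theorem isSpecialBigon_iff : A.IsSpecialBigon x y ↔ A.IsBigon x y ∧ A.isOver y = !A.isOver x := by
  constructor
  · rintro ⟨hx, hy, hxy, hαx, hαy, hreg, hout, hover⟩
    exact ⟨⟨hx, hy, hxy, hαx, hαy, hreg, hout⟩, by rw [hover, hαx, A.isOver_σ y hy, Bool.not_not]⟩
  · rintro ⟨⟨hx, hy, hxy, hαx, hαy, hreg, hout⟩, hover⟩
    exact ⟨hx, hy, hxy, hαx, hαy, hreg, hout, by rw [hαx, A.isOver_σ y hy, hover, Bool.not_not]⟩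

theorem IsBigon.symm (h : A.IsBigon x y) : A.IsBigon y x where
  isCrossing_left := h.isCrossing_right
  isCrossing_right := h.isCrossing_left
  not_sameCycle h' := h.not_sameCycle h'.symm
  α_left := h.α_right
  α_right := h.α_left
  reg_iff z := by
    have hxy : A.reg x y := (h.reg_iff y).2 (.inr rfl)
    rw [or_comm, ← h.reg_iff]
    exact ⟨A.reg.trans hxy, A.reg.trans (A.reg.symm hxy)⟩
  not_outer := (outer_iff_of_reg ((h.reg_iff y).2 (.inr rfl))).not.1 h.not_outer

theorem IsSpecialBigon.symm (h : A.IsSpecialBigon x y) : A.IsSpecialBigon y x := by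
  rw [isSpecialBigon_iff] at h ⊢
  exact ⟨h.1.symm, by rw [h.2, Bool.not_not]⟩

theorem IsMonogon.smooth (hz : A.IsMonogon z) (h : ¬ A.σ.SameCycle x z) :
    (A.smooth x).IsMonogon z := by
  obtain ⟨hc, hα, hreg, hout⟩ := hz
  have hav : A.AvoidsChannel x z := by
    rw [LinkDiagram.sameCycle_iff] at h
    exact ⟨fun h' => h (.inl (hreg _ h').symm), fun h' => h (.inr (.inr (.inl (hreg _ h').symm)))⟩
  exact ⟨hc.smooth h, hα.trans (smooth_σ_of_not_sameCycle h).symm,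
    fun w hw => hreg w ((hav.smooth_reg_iff w).1 hw), hav.smooth_outer_iff.not.2 hout⟩

theorem IsBigon.smooth (hzw : A.IsBigon z w) (hz : ¬ A.σ.SameCycle x z)
    (hw : ¬ A.σ.SameCycle x w) : (A.smooth x).IsBigon z w := by
  have hav : A.AvoidsChannel x z := by
    rw [LinkDiagram.sameCycle_iff] at hz hw
    constructor <;> grind [hzw.reg_iff]
  exact ⟨hzw.isCrossing_left.smooth hz, hzw.isCrossing_right.smooth hw,
    fun h => hzw.not_sameCycle (sameCycle_of_smooth h),
    hzw.α_left.trans (smooth_σ_of_not_sameCycle hw).symm,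
    hzw.α_right.trans (smooth_σ_of_not_sameCycle hz).symm,
    fun t => (hav.smooth_reg_iff t).trans (hzw.reg_iff t),
    hav.smooth_outer_iff.not.2 hzw.not_outer⟩

theorem IsSpecialBigon.smooth (hzw : A.IsSpecialBigon z w) (hz : ¬ A.σ.SameCycle x z)
    (hw : ¬ A.σ.SameCycle x w) : (A.smooth x).IsSpecialBigon z w :=
  have h := isSpecialBigon_iff.1 hzw
  isSpecialBigon_iff.2 ⟨h.1.smooth hz hw, h.2⟩

theorem IsIso.isMonogon {e : A.Dart ≃ B.Dart} (h : IsIso e) (hx : A.IsMonogon x) :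
    B.IsMonogon (e x) := by
  obtain ⟨hc, hα, hreg, hout⟩ := hx
  refine ⟨(h.isCrossing_iff x).2 hc, by rw [h.α, h.σ, hα], fun y hy => ?_, by rwa [h.outer]⟩
  obtain ⟨z, rfl⟩ := e.surjective y
  rw [hreg z ((h.reg _ _).1 hy)]

theorem IsIso.isBigon {e : A.Dart ≃ B.Dart} (h : IsIso e) (hxy : A.IsBigon x y) :
    B.IsBigon (e x) (e y) where
  isCrossing_left := (h.isCrossing_iff x).2 hxy.isCrossing_left
  isCrossing_right := (h.isCrossing_iff y).2 hxy.isCrossing_right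
  not_sameCycle := (h.sameCycle_iff x y).not.2 hxy.not_sameCycle
  α_left := by rw [h.α, h.σ, hxy.α_left]
  α_right := by rw [h.α, h.σ, hxy.α_right]
  reg_iff z := by
    obtain ⟨z, rfl⟩ := e.surjective z
    rw [h.reg, hxy.reg_iff, e.apply_eq_iff_eq, e.apply_eq_iff_eq]
  not_outer := (h.outer x).not.2 hxy.not_outer

theorem IsIso.isSpecialBigon {e : A.Dart ≃ B.Dart} (h : IsIso e) (hxy : A.IsSpecialBigon x y) :
    B.IsSpecialBigon (e x) (e y) := by
  rw [isSpecialBigon_iff] at hxy ⊢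
  exact ⟨h.isBigon hxy.1, by
    rw [h.isOver _ hxy.1.isCrossing_left, h.isOver _ hxy.1.isCrossing_right, hxy.2]⟩

end Faces

section DeleteFaces

variable {u x y z : A.Dart}

theorem IsCrossing.ne_of_removable (hz : A.IsCrossing z) (hu : A.Removable u) :
    z ≠ u ∧ z ≠ A.σ u := by
  grind [IsCrossing, Removable]

theorem Removable.delete_α_eq (hu : A.Removable u) {y z : hu.delete.Dart}
    (h : A.α y.1 = z.1) : hu.delete.α y = z :=
  Subtype.ext ((slide_of_ne (h ▸ z.2.1) (h ▸ z.2.2)).trans h)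

theorem IsMonogon.delete (hx : A.IsMonogon x) (hu : A.Removable u) :
    hu.delete.IsMonogon ⟨x, hx.1.ne_of_removable hu⟩ := by
  obtain ⟨hc, hα, hreg, hout⟩ := hx
  exact ⟨fun h => hc (congrArg Subtype.val h), hu.delete_α_eq hα,
    fun y hy => Subtype.ext (hreg y.1 hy), hout⟩

theorem IsSpecialBigon.delete (hxy : A.IsSpecialBigon x y) (hu : A.Removable u) :
    hu.delete.IsSpecialBigon ⟨x, hxy.1.ne_of_removable hu⟩
      ⟨y, hxy.2.1.ne_of_removable hu⟩ := by
  obtain ⟨h, hover⟩ := isSpecialBigon_iff.1 hxy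
  refine isSpecialBigon_iff.2 ⟨⟨fun h' => h.isCrossing_left (congrArg Subtype.val h'),
    fun h' => h.isCrossing_right (congrArg Subtype.val h'),
    fun h' => h.not_sameCycle ((Equiv.Perm.sameCycle_subtypePerm (h := hu.ne_iff)).1 h'),
    hu.delete_α_eq h.α_left, hu.delete_α_eq h.α_right, fun z => ?_, h.not_outer⟩, hover⟩
  exact (h.reg_iff z.1).trans (or_congr ⟨fun h => Subtype.ext h, congrArg Subtype.val⟩
    ⟨fun h => Subtype.ext h, congrArg Subtype.val⟩)

end DeleteFaces

section Step

variable {A' B B' : LinkDiagram X}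

/-- One simplification of diagrams drawn with their bivalent points: a bivalent point is forgotten,
or a monogon or a special bigon is opened. -/
inductive Step (A : LinkDiagram X) : LinkDiagram X → Prop
  | delete {u : A.Dart} (hu : A.Removable u) : Step A hu.delete
  | monogon {x : A.Dart} (hx : A.IsMonogon x) : Step A (A.smooth x)
  | bigon {x y : A.Dart} (hxy : A.IsSpecialBigon x y) : Step A ((A.smooth x).smooth y)

/-- Finitely many simplifications and isomorphisms. -/
def Simplifies : LinkDiagram X → LinkDiagram X → Prop := Relation.ReflTransGen (Step ⊔ Iso)

/-- The diagrams have a common simplification. -/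
def Joinable : LinkDiagram X → LinkDiagram X → Prop := Relation.Join Simplifies

theorem Step.exists_step_of_iso (h : Step A B) (hA : Iso A A') :
    ∃ B', Step A' B' ∧ Iso B B' := by
  obtain ⟨e, he⟩ := iso_iff.1 hA
  cases h with
  | delete hu => exact ⟨_, .delete (he.removable hu), he.delete hu⟩
  | monogon hx => exact ⟨_, .monogon (he.isMonogon hx), (he.smooth _).iso⟩
  | bigon hxy => exact ⟨_, .bigon (he.isSpecialBigon hxy), ((he.smooth _).smooth _).iso⟩

theorem Iso.simplifies (h : Iso A B) : Simplifies A B := .single (.inr h)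

theorem Step.simplifies (h : Step A B) : Simplifies A B := .single (.inl h)

theorem Iso.joinable (h : Iso A B) : Joinable A B := ⟨B, h.simplifies, .refl⟩

theorem Joinable.symm (h : Joinable A B) : Joinable B A := h.imp fun _ => And.symm

theorem Joinable.of_simplifies (h : Joinable A' B') (hA : Simplifies A A')
    (hB : Simplifies B B') : Joinable A B :=
  h.imp fun _ h => ⟨hA.trans h.1, hB.trans h.2⟩

/-- A termination measure for `Step`: the number of darts plus the number of darts at crossings. -/
noncomputable def size (A : LinkDiagram X) : ℕ :=
  Nat.card A.Dart + {x | A.IsCrossing x}.ncard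

theorem Removable.size_delete_lt {u : A.Dart} (hu : A.Removable u) : hu.delete.size < A.size := by
  have := A.finite
  refine add_lt_add_of_lt_of_le (Finite.card_subtype_lt (x := u) fun h => h.1 rfl) ?_
  exact Set.ncard_le_ncard_of_injOn Subtype.val
    (fun z hz h => hz (Subtype.ext h)) Subtype.val_injective.injOn

theorem size_smooth_le (A : LinkDiagram X) (x : A.Dart) : (A.smooth x).size ≤ A.size := by
  have := A.finite
  have hle : {z : A.Dart | (A.smooth x).IsCrossing z} ⊆ {z | A.IsCrossing z} :=
    fun z hz => IsCrossing.of_smooth hz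
  exact Nat.add_le_add_left (Set.ncard_le_ncard hle (Set.toFinite _)) _

theorem IsCrossing.size_smooth_lt {x : A.Dart} (hx : A.IsCrossing x) :
    (A.smooth x).size < A.size := by
  have := A.finite
  have hlt : {z : A.Dart | (A.smooth x).IsCrossing z} ⊂ {z | A.IsCrossing z} :=
    ⟨fun z hz => IsCrossing.of_smooth hz, fun h => A.not_isCrossing_smooth x (h hx)⟩
  exact Nat.add_lt_add_left (Set.ncard_lt_ncard hlt (Set.toFinite _)) _

theorem Step.size_lt (h : Step A B) : B.size < A.size := by
  cases h with
  | delete hu => exact hu.size_delete_lt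
  | monogon hx => exact hx.1.size_smooth_lt
  | bigon hxy => exact (size_smooth_le _ _).trans_lt hxy.1.size_smooth_lt

theorem wellFounded_swap_step : WellFounded (Function.swap (Step (X := X))) :=
  Subrelation.wf Step.size_lt (measure size).wf

theorem Step.sameLink (h : Step A B) : SameLink A B := by
  cases h with
  | delete hu => exact .rel _ _ (.inl hu.isotopic_delete)
  | @monogon x hx => exact .rel _ _ (.inr (.inl ⟨A, x, .refl _, hx, .refl _⟩))
  | @bigon x y hxy => exact .rel _ _ (.inr (.inr (.inl ⟨A, x, y, .refl _, hxy, .refl _⟩)))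

end Step

section DeleteSmooth

variable {u x y : A.Dart}

theorem Removable.smooth (hu : A.Removable u) (x : A.Dart) : (A.smooth x).Removable u := by
  have hσ : (A.smooth x).σ u = A.σ u := smooth_σ_of_not_isCrossing (not_not.2 hu.1) x
  have hσ' : (A.smooth x).σ (A.σ u) = u :=
    (smooth_σ_of_not_isCrossing (not_not.2 (by rw [hu.1])) x).trans hu.1
  exact ⟨(congrArg _ hσ).trans hσ', fun h => hu.2 (h.trans hσ)⟩

/-- The darts that remain when a bivalent point is forgotten are the same before and after a
smoothing. -/
def Removable.restEquiv (hu : A.Removable u) (x : A.Dart) : A.Rest u ≃ (A.smooth x).Rest u :=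
  Equiv.subtypeEquivRight fun _ =>
    have hσ : (A.smooth x).σ u = A.σ u := smooth_σ_of_not_isCrossing (not_not.2 hu.1) x
    and_congr_right fun _ => not_congr ⟨fun h => h.trans hσ.symm, fun h => h.trans hσ⟩

theorem Removable.coe_smooth_delete_σ (hu : A.Removable u) (x z : hu.delete.Dart) :
    ((hu.delete.smooth x).σ z).1 = (A.smooth x.1).σ z.1 :=
  congrArg A.σ (@Function.Injective.map_swap _ _ (Classical.decEq _) (Classical.decEq _) _
    Subtype.val_injective x (hu.delete.σ (hu.delete.σ x)) z)

theorem Removable.isIso_restEquiv (hu : A.Removable u) (x : hu.delete.Dart) :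
    IsIso (A := hu.delete.smooth x) (B := (hu.smooth x.1).delete) (hu.restEquiv x.1) := by
  have hσu : (A.smooth x.1).σ u = A.σ u := smooth_σ_of_not_isCrossing (not_not.2 hu.1) x.1
  refine ⟨fun z => Subtype.ext ?_, fun z => Subtype.ext (hu.coe_smooth_delete_σ x z).symm,
    fun _ _ => rfl, fun _ _ => Iff.rfl,
    fun z => ⟨?_, fun ⟨w, hw, hwz⟩ => ⟨w.1, hw, hwz⟩⟩⟩
  · exact congrArg (fun v => bypass A.α u v z.1) hσu
  · rintro ⟨w, hw, hwz⟩
    exact ⟨hu.retract w, (outer_iff_of_reg (hu.reg_retract w)).2 hw,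
      (A.smooth x.1).reg.trans (Or.inl (hu.reg_retract w)) hwz⟩

theorem Removable.simplifies_smooth (hu : A.Removable u) (x : hu.delete.Dart) :
    Simplifies (A.smooth x.1) (hu.delete.smooth x) :=
  (Step.delete (hu.smooth x.1)).simplifies.trans (hu.isIso_restEquiv x).symm.iso.simplifies

theorem Removable.simplifies_smooth_smooth (hu : A.Removable u) (x y : hu.delete.Dart) :
    Simplifies ((A.smooth x.1).smooth y.1) ((hu.delete.smooth x).smooth y) :=
  ((hu.smooth x.1).simplifies_smooth (hu.restEquiv x.1 y)).trans
    ((hu.isIso_restEquiv x).smooth y).symm.iso.simplifies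

theorem Removable.joinable_monogon (hu : A.Removable u) (hx : A.IsMonogon x) :
    Joinable hu.delete (A.smooth x) :=
  ⟨_, (Step.monogon (hx.delete hu)).simplifies,
    hu.simplifies_smooth ⟨x, hx.1.ne_of_removable hu⟩⟩

theorem Removable.joinable_bigon (hu : A.Removable u) (hxy : A.IsSpecialBigon x y) :
    Joinable hu.delete ((A.smooth x).smooth y) :=
  ⟨_, (Step.bigon (hxy.delete hu)).simplifies,
    hu.simplifies_smooth_smooth ⟨x, hxy.1.ne_of_removable hu⟩
      ⟨y, hxy.2.1.ne_of_removable hu⟩⟩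

end DeleteSmooth

section DeleteDelete

variable {u w : A.Dart}

theorem Removable.iso_of_sameVertex (hu : A.Removable u) (hw : A.Removable w)
    (h : w = u ∨ w = A.σ u) : Iso hu.delete hw.delete := by
  have hiff (z : A.Dart) : z ≠ u ∧ z ≠ A.σ u ↔ z ≠ w ∧ z ≠ A.σ w := by grind [Removable]
  have hα (z : A.Rest u) : bypass A.α w (A.σ w) z = bypass A.α u (A.σ u) z := by
    grind [bypass, slide, Removable]
  exact ⟨Equiv.subtypeEquivRight hiff, fun z => Subtype.ext (hα z), fun _ => rfl,
    fun _ _ => rfl, fun _ _ => Iff.rfl, fun _ => Iff.rfl⟩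

theorem Removable.iso_of_circle (hu : A.Removable u) (hw : A.Removable w) (hwu : w ≠ u)
    (hwu' : w ≠ A.σ u) (h : bypass A.α u (A.σ u) w = A.σ w) : Iso hu.delete hw.delete := by
  let e : A.Rest u ≃ A.Rest w :=
    { toFun z := hw.retract z
      invFun z := hu.retract z
      left_inv z := Subtype.ext <| by
        have := z.2
        change slide A.α u (A.σ u) (slide A.α w (A.σ w) z) = z
        grind [slide, bypass, Removable, A.α_α, A.σ.injective.eq_iff, A.α_ne, A.σ_ne]
      right_inv z := Subtype.ext <| by
        have := z.2
        change slide A.α w (A.σ w) (slide A.α u (A.σ u) z) = z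
        grind [slide, bypass, Removable, A.α_α, A.σ.injective.eq_iff, A.α_ne, A.σ_ne] }
  refine ⟨e, fun z => Subtype.ext ?_, fun z => Subtype.ext ?_, fun z hz => ?_, fun y z => ?_,
    fun z => outer_iff_of_reg (hw.reg_retract z.1)⟩
  · have := z.2
    change bypass A.α w (A.σ w) (slide A.α w (A.σ w) z.1) =
      slide A.α w (A.σ w) (bypass A.α u (A.σ u) z.1)
    grind [slide, bypass, Removable, A.α_α, A.σ.injective.eq_iff, A.α_ne, A.σ_ne]
  · have := z.2
    change A.σ (slide A.α w (A.σ w) z.1) = slide A.α w (A.σ w) (A.σ z.1)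
    grind [slide, bypass, Removable, A.α_α, A.σ.injective.eq_iff, A.α_ne, A.σ_ne]
  · have hc : A.IsCrossing z.1 := fun h0 => hz (Subtype.ext h0)
    have hz' := hc.ne_of_removable hw
    exact congrArg A.isOver (slide_of_ne hz'.1 hz'.2)
  · have hy := hw.reg_retract y.1
    have hz := hw.reg_retract z.1
    exact ⟨fun k => A.reg.trans (A.reg.symm hy) (A.reg.trans k hz),
      fun k => A.reg.trans hy (A.reg.trans k (A.reg.symm hz))⟩

theorem Removable.coe_delete_delete_α (hu : A.Removable u) {w : hu.delete.Dart}
    (hw : hu.delete.Removable w) (z : hw.delete.Dart) :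
    (hw.delete.α z).1.1 = bypass (bypass A.α u (A.σ u)) w.1 (A.σ w.1) z.1.1 :=
  map_bypass Subtype.val_injective hu.coe_delete_α

theorem Removable.iso_delete_delete (hu : A.Removable u) (hw : A.Removable w)
    (hwu : w ≠ u ∧ w ≠ A.σ u) (huw : u ≠ w ∧ u ≠ A.σ w)
    (hw' : hu.delete.Removable ⟨w, hwu⟩) (hu' : hw.delete.Removable ⟨u, huw⟩) :
    Iso hw'.delete hu'.delete := by
  let e : hw'.delete.Dart ≃ hu'.delete.Dart :=
    { toFun z := ⟨⟨z.1.1, fun e => z.2.1 (Subtype.ext e), fun e => z.2.2 (Subtype.ext e)⟩,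
        fun e => z.1.2.1 (congrArg Subtype.val e), fun e => z.1.2.2 (congrArg Subtype.val e)⟩
      invFun z := ⟨⟨z.1.1, fun e => z.2.1 (Subtype.ext e), fun e => z.2.2 (Subtype.ext e)⟩,
        fun e => z.1.2.1 (congrArg Subtype.val e), fun e => z.1.2.2 (congrArg Subtype.val e)⟩
      left_inv _ := rfl
      right_inv _ := rfl }
  refine ⟨e, fun z => Subtype.ext (Subtype.ext ?_), fun _ => rfl, fun _ _ => rfl,
    fun _ _ => Iff.rfl, fun _ => Iff.rfl⟩
  refine (hw.coe_delete_delete_α hu' (e z)).trans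
    (Eq.trans ?_ (hu.coe_delete_delete_α hw' z).symm)
  exact (bypass_comm A.α_α (A.σ_ne u).symm (A.σ_ne w).symm hwu.1 hwu.2 (by grind [Removable])
    (A.σ.injective.ne hwu.1)
    (fun h => hw'.2 (Subtype.ext h)) z.1.2.1 z.1.2.2 fun h => z.2.1 (Subtype.ext h)).symm

theorem Removable.joinable_delete (hu : A.Removable u) (hw : A.Removable w) :
    Joinable hu.delete hw.delete := by
  by_cases hwu : w = u ∨ w = A.σ u
  · exact (hu.iso_of_sameVertex hw hwu).joinable
  rw [not_or] at hwu
  by_cases h : bypass A.α u (A.σ u) w = A.σ w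
  · exact (hu.iso_of_circle hw hwu.1 hwu.2 h).joinable
  have huw : u ≠ w ∧ u ≠ A.σ w := by grind [Removable]
  have hw' : hu.delete.Removable ⟨w, hwu⟩ :=
    ⟨Subtype.ext hw.1, fun h' => h (congrArg Subtype.val h')⟩
  have hu' : hw.delete.Removable ⟨u, huw⟩ :=
    ⟨Subtype.ext hu.1, fun h' => bypass_ne_symm A.α_α hu.2 h (congrArg Subtype.val h')⟩
  exact (hu.iso_delete_delete hw hwu huw hw' hu').joinable.of_simplifies
    (Step.delete hw').simplifies (Step.delete hu').simplifies

end DeleteDelete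

section Resolve

variable {y : A.Dart}

/-- The edges of the darts `y` and `σ y` lead from the crossing at `y` to other vertices. -/
structure Resolvable (A : LinkDiagram X) (y : A.Dart) : Prop where
  isCrossing : A.IsCrossing y
  not_sameCycle : ¬ A.σ.SameCycle y (A.α y)
  not_sameCycle_next : ¬ A.σ.SameCycle y (A.α (A.σ y))

namespace Resolvable

theorem removable_self (h : A.Resolvable y) : (A.smooth y).Removable y := by
  refine ⟨(congrArg _ (A.smooth_σ_self y)).trans (A.smooth_σ_prev y), fun h' => ?_⟩
  have h' : A.α y = A.σ (A.σ (A.σ y)) := h'.trans (A.smooth_σ_self y)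
  exact h.not_sameCycle (by rw [h', LinkDiagram.sameCycle_iff]; grind)

theorem next_ne (h : A.Resolvable y) : A.σ y ≠ y ∧ A.σ y ≠ (A.smooth y).σ y := by
  grind [Resolvable, IsCrossing, A.smooth_σ_self y, A.σ_ne, A.σ.injective.eq_iff]

theorem removable_next (h : A.Resolvable y) :
    h.removable_self.delete.Removable ⟨A.σ y, h.next_ne⟩ := by
  refine ⟨Subtype.ext ((congrArg _ (A.smooth_σ_next y)).trans (A.smooth_σ_opposite y)),
    fun h' => ?_⟩
  have h' : bypass A.α y ((A.smooth y).σ y) (A.σ y) = (A.smooth y).σ (A.σ y) :=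
    congrArg Subtype.val h'
  have := h.not_sameCycle_next
  rw [LinkDiagram.sameCycle_iff] at this
  rw [smooth_σ_self, smooth_σ_next] at h'
  grind [bypass, slide]

/-- The diagram smoothed at `y`, without the two new bivalent points. -/
noncomputable def resolve (h : A.Resolvable y) : LinkDiagram X := h.removable_next.delete

theorem simplifies_resolve (h : A.Resolvable y) : Simplifies (A.smooth y) h.resolve :=
  (Step.delete h.removable_self).simplifies.trans (Step.delete h.removable_next).simplifies

/-- The dart of `A` that gives a dart of the resolved diagram. -/
def coe (h : A.Resolvable y) (z : h.resolve.Dart) : A.Dart := z.1.1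

theorem coe_injective (h : A.Resolvable y) : h.coe.Injective :=
  fun _ _ h' => Subtype.ext (Subtype.ext h')

theorem range_coe (h : A.Resolvable y) : Set.range h.coe = {z | ¬ A.σ.SameCycle y z} := by
  refine Set.ext fun z => Iff.trans ?_ (A.sameCycle_iff y z).not.symm
  constructor
  · rintro ⟨z, rfl⟩ (h' | h' | h' | h')
    · exact z.1.2.1 h'
    · exact z.2.1 (Subtype.ext h')
    · exact z.2.2 (Subtype.ext (h'.trans (A.smooth_σ_next y).symm))
    · exact z.1.2.2 (h'.trans (A.smooth_σ_self y).symm)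
  · intro hz
    exact ⟨⟨⟨z, fun h' => hz (.inl h'),
        fun h' => hz (.inr (.inr (.inr (h'.trans (A.smooth_σ_self y)))))⟩,
      fun h' => hz (.inr (.inl (congrArg Subtype.val h'))),
      fun h' => hz (.inr (.inr (.inl ((congrArg Subtype.val h').trans (A.smooth_σ_next y)))))⟩, rfl⟩

theorem not_sameCycle_coe (h : A.Resolvable y) (z : h.resolve.Dart) :
    ¬ A.σ.SameCycle y (h.coe z) :=
  h.range_coe.subset ⟨z, rfl⟩

theorem coe_σ (h : A.Resolvable y) (z : h.resolve.Dart) : h.coe (h.resolve.σ z) = A.σ (h.coe z) :=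
  smooth_σ_of_not_sameCycle (h.not_sameCycle_coe z)

theorem coe_α (h : A.Resolvable y) (z : h.resolve.Dart) : h.coe (h.resolve.α z) =
    bypass (bypass A.α y (A.σ (A.σ (A.σ y)))) (A.σ y) (A.σ (A.σ y)) (h.coe z) := by
  rw [← smooth_σ_self, ← smooth_σ_next]
  exact h.removable_self.coe_delete_delete_α h.removable_next z

end Resolvable

end Resolve

section Flatten

variable {x y z w : A.Dart}

theorem smooth_reg_iff_of_not_reg (hy : ¬ A.reg y x) (hz : ¬ A.reg z x) :
    (A.smooth x).reg y z ↔ A.reg y z :=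
  ⟨fun h => h.elim id fun ⟨hy', hz'⟩ =>
    A.reg.trans (hy'.resolve_left hy) (A.reg.symm (hz'.resolve_left hz)), Or.inl⟩

theorem smooth_outer_iff_of_not_reg (hy : ¬ A.reg y x) (hx : ¬ A.outer x) :
    (A.smooth x).outer y ↔ A.outer y := by
  refine ⟨?_, fun h => ⟨y, h, (A.smooth x).reg.refl y⟩⟩
  rintro ⟨w, hw, hwy⟩
  have hwx : ¬ A.reg w x := fun h => hx ((outer_iff_of_reg h).1 hw)
  exact (outer_iff_of_reg ((smooth_reg_iff_of_not_reg hwx hy).1 hwy)).1 hw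

open Classical in
/-- For a bigon with corners `y` and `w` that is flattened to a single crossing: the edges of the
bigon are contracted to the edges that continue them beyond `y`. -/
noncomputable def flatten (A : LinkDiagram X) (y w z : A.Dart) : A.Dart :=
  if z = w then A.σ (A.σ y) else if z = A.σ w then A.σ (A.σ (A.σ y)) else z

open Classical in
/-- The cyclic order at the vertices once the bigon with corners `y` and `w` has been flattened. -/
noncomputable def flattenσ (A : LinkDiagram X) (y w z : A.Dart) : A.Dart :=
  if z = A.σ (A.σ (A.σ y)) then A.σ (A.σ w) else
    if z = A.σ (A.σ (A.σ w)) then A.σ (A.σ y) else A.σ z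

namespace IsBigon

theorem nodup (h : A.IsBigon y w) : [y, A.σ y, A.σ (A.σ y), A.σ (A.σ (A.σ y)),
    w, A.σ w, A.σ (A.σ w), A.σ (A.σ (A.σ w))].Nodup := by
  have := h.not_sameCycle
  have := h.isCrossing_left
  have := h.isCrossing_right
  simp only [List.nodup_cons, List.mem_cons, not_or, List.not_mem_nil]
  grind [IsCrossing, LinkDiagram.sameCycle_iff, A.σ_four, A.σ_ne, A.σ.injective.eq_iff]

theorem resolvable (h : A.IsBigon y w) : A.Resolvable y where
  isCrossing := h.isCrossing_left
  not_sameCycle := by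
    rw [h.α_left, Equiv.Perm.sameCycle_apply_right]
    exact h.not_sameCycle
  not_sameCycle_next := by
    rw [← h.α_right, A.α_α]
    exact h.not_sameCycle

theorem flattenσ_comm (h : A.IsBigon y w) : A.flattenσ y w = A.flattenσ w y := by
  have := h.nodup
  ext z
  grind [flattenσ]

/-- The dart of the flattened bigon that a dart of the diagram resolved at `y` becomes. -/
noncomputable def flat (h : A.IsBigon y w) (z : h.resolvable.resolve.Dart) : A.Dart :=
  A.flatten y w (h.resolvable.coe z)

theorem flat_injective (h : A.IsBigon y w) : h.flat.Injective := by
  intro z z' hzz'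
  have hz := (A.sameCycle_iff _ _).not.1 (h.resolvable.not_sameCycle_coe z)
  have hz' := (A.sameCycle_iff _ _).not.1 (h.resolvable.not_sameCycle_coe z')
  have := h.nodup
  refine h.resolvable.coe_injective ?_
  grind [flat, flatten]

theorem mem_range_flat (h : A.IsBigon y w) (z : A.Dart) :
    z ∈ Set.range h.flat ↔ z ≠ y ∧ z ≠ A.σ y ∧ z ≠ w ∧ z ≠ A.σ w := by
  have := h.nodup
  constructor
  · rintro ⟨z, rfl⟩
    have hz := (A.sameCycle_iff _ _).not.1 (h.resolvable.not_sameCycle_coe z)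
    grind [flat, flatten]
  · intro hz
    suffices ∃ t, ¬ A.σ.SameCycle y t ∧ A.flatten y w t = z by
      obtain ⟨t, ht, rfl⟩ := this
      obtain ⟨t, rfl⟩ := h.resolvable.range_coe.superset ht
      exact ⟨t, rfl⟩
    by_cases h2 : z = A.σ (A.σ y)
    · exact ⟨w, h.not_sameCycle, by grind [flatten]⟩
    by_cases h3 : z = A.σ (A.σ (A.σ y))
    · exact ⟨A.σ w, fun h' => h.not_sameCycle (Equiv.Perm.sameCycle_apply_right.1 h'),
        by grind [flatten]⟩
    exact ⟨z, by rw [LinkDiagram.sameCycle_iff]; grind, by grind [flatten]⟩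

theorem flat_σ (h : A.IsBigon y w) (z : h.resolvable.resolve.Dart) :
    h.flat (h.resolvable.resolve.σ z) = A.flattenσ y w (h.flat z) := by
  have hz := (A.sameCycle_iff _ _).not.1 (h.resolvable.not_sameCycle_coe z)
  have := h.nodup
  rw [flat, flat, Resolvable.coe_σ]
  grind [flatten, flattenσ, A.σ_four, A.σ.injective.eq_iff]

theorem flat_α (h : A.IsBigon y w) (z : h.resolvable.resolve.Dart) :
    h.flat (h.resolvable.resolve.α z) = A.α (h.flat z) := by
  have hz := (A.sameCycle_iff _ _).not.1 (h.resolvable.not_sameCycle_coe z)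
  have := h.nodup
  have hy := h.α_left
  have hw := h.α_right
  have hy' : A.α (A.σ w) = y := by rw [← hy, A.α_α]
  have hw' : A.α (A.σ y) = w := by rw [← hw, A.α_α]
  rw [flat, flat, Resolvable.coe_α]
  generalize h.resolvable.coe z = t at hz ⊢
  grind (splits := 15) [flatten, bypass, slide, A.α_α]

theorem isOver_flat (h : A.IsBigon y w) (ho : A.isOver y = A.isOver w)
    (z : h.resolvable.resolve.Dart) : A.isOver (h.flat z) = h.resolvable.resolve.isOver z := by
  have h0 := h.isCrossing_left
  have h1 := A.isOver_σ y h0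
  have h2 := A.isOver_σ (A.σ y) h0.next
  have h3 := A.isOver_σ (A.σ (A.σ y)) h0.next.next
  have h4 := A.isOver_σ w h.isCrossing_right
  change A.isOver (A.flatten y w z.1.1) = A.isOver z.1.1
  grind [flatten]

theorem not_reg_flat (h : A.IsBigon y w) (z : h.resolvable.resolve.Dart) :
    ¬ A.reg (h.flat z) y := by
  intro h'
  have hz := (h.mem_range_flat _).1 ⟨z, rfl⟩
  exact ((h.reg_iff _).1 (A.reg.symm h')).elim hz.1 hz.2.2.1

theorem smooth_reg_flat (h : A.IsBigon y w) (z : h.resolvable.resolve.Dart) :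
    (A.smooth y).reg (h.flat z) (h.resolvable.coe z) := by
  have hα := A.reg_corner (A.σ (A.σ (A.σ y)))
  rw [A.σ_four, h.α_left] at hα
  unfold flat flatten
  split_ifs with h0 h1
  · rw [h0]
    exact .inr ⟨.inr (A.reg.refl _), .inl (A.reg.symm ((h.reg_iff _).2 (.inr rfl)))⟩
  · rw [h1]
    exact .inl (A.reg.symm hα)
  · exact (A.smooth y).reg.refl _

theorem reg_flat (h : A.IsBigon y w) (z z' : h.resolvable.resolve.Dart) :
    A.reg (h.flat z) (h.flat z') ↔ h.resolvable.resolve.reg z z' := by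
  have hz := h.smooth_reg_flat z
  have hz' := h.smooth_reg_flat z'
  rw [← smooth_reg_iff_of_not_reg (h.not_reg_flat z) (h.not_reg_flat z')]
  exact ⟨fun h' => (A.smooth y).reg.trans ((A.smooth y).reg.symm hz)
      ((A.smooth y).reg.trans h' hz'),
    fun h' => (A.smooth y).reg.trans hz ((A.smooth y).reg.trans h' ((A.smooth y).reg.symm hz'))⟩

theorem outer_flat (h : A.IsBigon y w) (z : h.resolvable.resolve.Dart) :
    A.outer (h.flat z) ↔ h.resolvable.resolve.outer z := by
  rw [← smooth_outer_iff_of_not_reg (h.not_reg_flat z) h.not_outer]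
  exact outer_iff_of_reg (h.smooth_reg_flat z)

theorem resolve_iso (h : A.IsBigon y w) (ho : A.isOver y = A.isOver w) :
    Iso h.resolvable.resolve h.symm.resolvable.resolve := by
  have hrange : Set.range h.flat = Set.range h.symm.flat := by
    ext z
    rw [mem_range_flat, mem_range_flat]
    tauto
  let e : h.resolvable.resolve.Dart ≃ h.symm.resolvable.resolve.Dart :=
    (Equiv.ofInjective _ h.flat_injective).trans
      ((Equiv.setCongr hrange).trans (Equiv.ofInjective _ h.symm.flat_injective).symm)
  have he (z) : h.symm.flat (e z) = h.flat z :=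
    Equiv.apply_ofInjective_symm h.symm.flat_injective _
  refine IsIso.iso (e := e) ⟨fun z => h.symm.flat_injective ?_, fun z => h.symm.flat_injective ?_,
    fun z _ => ?_, fun z z' => ?_, fun z => ?_⟩
  · rw [flat_α, he, he, flat_α]
  · rw [flat_σ, he, he, flat_σ, h.flattenσ_comm]
  · rw [← h.isOver_flat ho, ← h.symm.isOver_flat ho.symm, he]
  · rw [← h.reg_flat, ← h.symm.reg_flat, he, he]
  · rw [← h.outer_flat, ← h.symm.outer_flat, he]

theorem joinable_smooth (h : A.IsBigon y w) (ho : A.isOver y = A.isOver w) :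
    Joinable (A.smooth y) (A.smooth w) :=
  (h.resolve_iso ho).joinable.of_simplifies h.resolvable.simplifies_resolve
    h.symm.resolvable.simplifies_resolve

end IsBigon

end Flatten

section SplitUnknot

variable {x y z w : A.Dart}

theorem IsSpecialBigon.isBigon (h : A.IsSpecialBigon x y) : A.IsBigon x y :=
  (isSpecialBigon_iff.1 h).1

theorem component_subset {S : Set A.Dart} (hα : Set.MapsTo A.α S S) (hσ : Set.MapsTo A.σ S S)
    (hx : x ∈ S) : A.component x ⊆ S := by
  have hα' (t) : A.α t ∈ S ↔ t ∈ S := ⟨fun h => A.α_α t ▸ hα h, fun h => hα h⟩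
  have hσ' (t) : A.σ t ∈ S ↔ t ∈ S := ⟨fun h => A.σ_four t ▸ hσ (hσ (hσ h)), fun h => hσ h⟩
  have hop (t) : A.opposite t ∈ S ↔ t ∈ S := by
    unfold opposite
    split_ifs
    · rw [hσ', hσ']
    · exact hσ' t
  have heq : Equivalence fun s t => s ∈ S ↔ t ∈ S := ⟨fun _ => Iff.rfl, Iff.symm, Iff.trans⟩
  refine fun t ht => (heq.eqvGen_iff.1 (ht.mono ?_)).1 hx
  rintro s t (rfl | rfl)
  exacts [(hα' s).symm, (hop s).symm]

theorem hasSplitUnknotComponent_of_mapsTo {S : Set A.Dart} (hα : Set.MapsTo A.α S S)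
    (hσ : Set.MapsTo A.σ S S) (hS : ∀ t ∈ S, ¬ A.IsCrossing t) (hx : x ∈ S) (hz : z ∉ S) :
    A.HasSplitUnknotComponent :=
  ⟨A, .refl A, x, fun t ht => hS t (component_subset hα hσ hx ht), z,
    fun h => hz (component_subset hα hσ hx h)⟩

theorem SameLink.hasSplitUnknotComponent {B : LinkDiagram X} (h : SameLink A B)
    (hB : B.HasSplitUnknotComponent) : A.HasSplitUnknotComponent :=
  hB.imp fun _ => And.imp_left (h.trans _ _ _)

theorem smooth_smooth_σ_of_left (h : ¬ A.σ.SameCycle x y) (hz : A.σ.SameCycle x z) :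
    ((A.smooth x).smooth y).σ z = (A.smooth x).σ z :=
  smooth_σ_of_not_sameCycle fun h' => h (hz.trans (sameCycle_of_smooth h').symm)

theorem smooth_smooth_σ_of_right (h : ¬ A.σ.SameCycle x y) (hz : A.σ.SameCycle y z) :
    ((A.smooth x).smooth y).σ z = (A.smooth y).σ z :=
  ((smooth_smooth_comm h).σ z).symm.trans (smooth_smooth_σ_of_left (fun h' => h h'.symm) hz)

/-- Opening the first of two neighbouring bigons turns the boundary of the second one into a closed
curve without crossings. -/
theorem hasSplitUnknotComponent_of_adjacent (h : A.IsSpecialBigon x y)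
    (h' : A.IsSpecialBigon (A.σ x) w) : A.HasSplitUnknotComponent := by
  have hxy := h.isBigon.not_sameCycle
  have hw : A.σ w = y := by rw [← h'.isBigon.α_left, ← h.isBigon.α_right, A.α_α]
  have hx₁ : ((A.smooth x).smooth y).σ (A.σ x) = A.σ (A.σ x) :=
    (smooth_smooth_σ_of_left hxy (by simp [Equiv.Perm.SameCycle.rfl])).trans (A.smooth_σ_next x)
  have hx₂ : ((A.smooth x).smooth y).σ (A.σ (A.σ x)) = A.σ x :=
    (smooth_smooth_σ_of_left hxy (by simp [Equiv.Perm.SameCycle.rfl])).trans (A.smooth_σ_opposite x)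
  have hy₀ : ((A.smooth x).smooth y).σ y = A.σ (A.σ (A.σ y)) :=
    (smooth_smooth_σ_of_right hxy .rfl).trans (A.smooth_σ_self y)
  have hy₃ : ((A.smooth x).smooth y).σ (A.σ (A.σ (A.σ y))) = y :=
    (smooth_smooth_σ_of_right hxy (by simp [Equiv.Perm.SameCycle.rfl])).trans (A.smooth_σ_prev y)
  have hα : A.α (A.σ (A.σ x)) = A.σ (A.σ (A.σ y)) := by
    rw [← h'.isBigon.α_right, A.α_α, ← hw, A.σ_four]
  suffices ((A.smooth x).smooth y).HasSplitUnknotComponent from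
    (Step.bigon h).sameLink.hasSplitUnknotComponent this
  refine hasSplitUnknotComponent_of_mapsTo (x := A.σ x) (z := x)
    (S := {t : A.Dart | t = A.σ x ∨ t = A.σ (A.σ x) ∨ t = y ∨ t = A.σ (A.σ (A.σ y))})
    ?_ ?_ ?_ (.inl rfl) fun (hx : _ ∨ _ ∨ _ ∨ _) => ?_
  · rintro (t : A.Dart) (rfl | rfl | rfl | rfl)
    · exact .inr (.inr (.inl (h.isBigon.α_right ▸ A.α_α y)))
    · exact .inr (.inr (.inr hα))
    · exact .inl h.isBigon.α_right
    · exact .inr (.inl (hα ▸ A.α_α _))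
  · rintro (t : A.Dart) (rfl | rfl | rfl | rfl)
    exacts [.inr (.inl hx₁), .inl hx₂, .inr (.inr (.inr hy₀)), .inr (.inr (.inl hy₃))]
  · rintro (t : A.Dart) (rfl | rfl | rfl | rfl) hc
    exacts [hc (by rw [hx₁, hx₂]), hc (by rw [hx₂, hx₁]), hc (by rw [hy₀, hy₃]),
      hc (by rw [hy₃, hy₀])]
  · rw [LinkDiagram.sameCycle_iff] at hxy
    grind [A.σ_ne, A.σ_four, h.1, IsCrossing]

end SplitUnknot

section CriticalPairs

variable {x y z w : A.Dart}

theorem joinable_monogon_monogon (hx : A.IsMonogon x) (hz : A.IsMonogon z) :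
    Joinable (A.smooth x) (A.smooth z) := by
  by_cases h : A.σ.SameCycle x z
  · have : z = x ∨ z = A.σ (A.σ x) := by
      rw [LinkDiagram.sameCycle_iff] at h
      have := A.α_α x
      have := A.α_α z
      grind [IsMonogon, IsCrossing, A.σ_four]
    rcases this with rfl | rfl
    · exact (iso_equivalence.refl _).joinable
    · exact (A.smooth_opposite_isIso x).iso.joinable.symm
  · exact (smooth_smooth_comm h).iso.joinable.of_simplifies (Step.monogon (hz.smooth h)).simplifies
      (Step.monogon (hx.smooth fun h' => h h'.symm)).simplifies

theorem IsSpecialBigon.smooth_comm (h : A.IsSpecialBigon x y) :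
    Iso ((A.smooth x).smooth y) ((A.smooth y).smooth x) :=
  (smooth_smooth_comm h.isBigon.not_sameCycle).iso

namespace Resolvable

theorem simplifies_smooth (h : A.Resolvable x) (z : h.resolve.Dart) :
    Simplifies ((A.smooth x).smooth (h.coe z)) (h.resolve.smooth z) :=
  (h.removable_self.simplifies_smooth z.1).trans (h.removable_next.simplifies_smooth z)

theorem isCrossing_coe (h : A.Resolvable x) (z : h.resolve.Dart) :
    A.IsCrossing (h.coe z) ↔ h.resolve.IsCrossing z := by
  unfold IsCrossing
  rw [← h.coe_injective.ne_iff, coe_σ, coe_σ]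

theorem sameCycle_coe (h : A.Resolvable x) (z w : h.resolve.Dart) :
    A.σ.SameCycle (h.coe z) (h.coe w) ↔ h.resolve.σ.SameCycle z w := by
  simp only [LinkDiagram.sameCycle_iff, ← h.coe_injective.eq_iff, coe_σ]

variable (h : A.Resolvable x) {y z w : h.resolve.Dart}

theorem coe_resolve_α (hy : A.IsBigon x (h.coe y)) :
    h.coe (h.resolve.α y) = slide A.α x (A.σ (A.σ (A.σ x))) (A.α (A.σ (A.σ x))) := by
  have := A.σ_ne x
  have := h.isCrossing
  simp only [coe_α, bypass, hy.α_right]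
  rw [slide_of_ne (z := A.σ x) (A.σ_ne x) (fun h => this (A.σ.injective h).symm), slide, if_pos rfl]
  rfl

theorem reg_resolve_iff (hy : A.IsBigon x (h.coe y)) (hz : z ≠ y) :
    h.resolve.reg y z ↔ A.reg (A.σ (A.σ x)) (h.coe z) := by
  have hyx : A.reg (h.coe y) x := A.reg.symm ((hy.reg_iff _).2 (.inr rfl))
  have hzx : ¬ A.reg x (h.coe z) := fun h' => ((hy.reg_iff _).1 h').elim
    (fun h' => h.not_sameCycle_coe z (by rw [h'])) fun h' => hz (h.coe_injective h')
  constructor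
  · rintro (h' | ⟨-, h' | h'⟩)
    · exact absurd (A.reg.trans (A.reg.symm hyx) h') hzx
    · exact absurd (A.reg.symm h') hzx
    · exact A.reg.symm h'
  · exact fun h' => .inr ⟨.inl hyx, .inr (A.reg.symm h')⟩

theorem not_outer_resolve (hy : A.IsBigon x (h.coe y)) (hx : ¬ A.outer (A.σ (A.σ x))) :
    ¬ h.resolve.outer y := by
  have hyx : A.reg (h.coe y) x := A.reg.symm ((hy.reg_iff _).2 (.inr rfl))
  rintro ⟨t, ht, h' | ⟨h' | h', -⟩⟩
  · exact hy.not_outer ((outer_iff_of_reg (A.reg.trans h' hyx)).1 ht)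
  · exact hy.not_outer ((outer_iff_of_reg h').1 ht)
  · exact hx ((outer_iff_of_reg h').1 ht)

theorem isMonogon_resolve (hy : A.IsBigon x (h.coe y)) (hx : A.IsMonogon (A.σ (A.σ x))) :
    h.resolve.IsMonogon y := by
  refine ⟨(h.isCrossing_coe y).1 hy.isCrossing_right, h.coe_injective ?_, fun z hz => ?_,
    h.not_outer_resolve hy hx.2.2.2⟩
  · rw [h.coe_resolve_α hy, coe_σ, hx.2.1, slide, if_neg, if_pos rfl, hy.α_left]
    grind [A.σ_four, A.σ_ne]
  · by_contra hzy
    have := hx.2.2.1 _ ((h.reg_resolve_iff hy hzy).1 hz)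
    exact h.not_sameCycle_coe z (by rw [this, LinkDiagram.sameCycle_iff]; tauto)

theorem isBigon_resolve (hy : A.IsBigon x (h.coe y)) (hw : A.IsBigon (A.σ (A.σ x)) (h.coe w))
    (hyw : ¬ A.σ.SameCycle (h.coe y) (h.coe w)) : h.resolve.IsBigon y w := by
  have hx := (A.sameCycle_iff _ _).not.1 (h.not_sameCycle_coe w)
  refine ⟨(h.isCrossing_coe y).1 hy.isCrossing_right, (h.isCrossing_coe w).1 hw.isCrossing_right,
    (h.sameCycle_coe y w).not.1 hyw, h.coe_injective ?_, ?_, fun z => ?_,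
    h.not_outer_resolve hy hw.not_outer⟩
  · rw [h.coe_resolve_α hy, coe_σ, hw.α_left, slide_of_ne] <;>
      grind [A.σ_four, A.σ.injective.eq_iff]
  · refine h.coe_injective ?_
    have hσ : slide A.α x (A.σ (A.σ (A.σ x))) (A.σ (A.σ (A.σ x))) = A.σ (h.coe y) := by
      rw [slide, if_neg (by grind [A.σ_four, A.σ_ne]), if_pos rfl, hy.α_left]
    have hy' := (A.sameCycle_iff _ _).not.1 (h.not_sameCycle_coe (h.resolve.σ y))
    simp only [coe_σ] at hy'
    simp only [coe_α, coe_σ, bypass, hw.α_right, hσ]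
    exact slide_of_ne (by tauto) (by tauto)
  · by_cases hzy : z = y
    · exact iff_of_true (hzy ▸ h.resolve.reg.refl _) (.inl hzy)
    · rw [h.reg_resolve_iff hy hzy, hw.reg_iff, h.coe_injective.eq_iff]
      refine or_congr_left (iff_of_false (fun h' => ?_) hzy)
      exact h.not_sameCycle_coe z (by rw [h', LinkDiagram.sameCycle_iff]; tauto)

end Resolvable

theorem IsMonogon.eq_opposite (hz : A.IsMonogon z) (h : A.IsBigon x y)
    (hxz : A.σ.SameCycle x z) : z = A.σ (A.σ x) := by
  rw [LinkDiagram.sameCycle_iff] at hxz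
  have hxy := (A.sameCycle_iff x y).not.1 h.not_sameCycle
  have hα := hz.2.1
  have := A.α_α y
  have := A.α_α z
  grind [h.α_left, h.α_right, A.σ_four, A.σ.injective.eq_iff]

theorem joinable_monogon_bigon_of_sameCycle (hz : A.IsMonogon z) (h : A.IsSpecialBigon x y)
    (hxz : A.σ.SameCycle x z) : Joinable (A.smooth z) ((A.smooth x).smooth y) := by
  obtain rfl := hz.eq_opposite h.isBigon hxz
  have hr := h.isBigon.resolvable
  obtain ⟨y, rfl⟩ := hr.range_coe.superset h.isBigon.not_sameCycle
  refine ⟨_, ?_, hr.simplifies_smooth y⟩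
  exact ((A.smooth_opposite_isIso x).iso.simplifies.trans hr.simplifies_resolve).trans
    (Step.monogon (hr.isMonogon_resolve h.isBigon hz)).simplifies

theorem joinable_monogon_bigon (hz : A.IsMonogon z) (h : A.IsSpecialBigon x y) :
    Joinable (A.smooth z) ((A.smooth x).smooth y) := by
  by_cases hxz : A.σ.SameCycle x z
  · exact joinable_monogon_bigon_of_sameCycle hz h hxz
  by_cases hyz : A.σ.SameCycle y z
  · exact (joinable_monogon_bigon_of_sameCycle hz h.symm hyz).of_simplifies .refl
      h.smooth_comm.simplifies
  have hbigon := h.smooth (fun h' => hxz h'.symm) fun h' => hyz h'.symm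
  have hmonogon := (hz.smooth hxz).smooth fun h' => hyz (sameCycle_of_smooth h')
  exact (smooth_smooth_smooth_comm hxz hyz).symm.iso.joinable.of_simplifies
    (Step.bigon hbigon).simplifies (Step.monogon hmonogon).simplifies

theorem IsSpecialBigon.isOver_right (h : A.IsSpecialBigon x y)
    (h' : A.IsSpecialBigon (A.σ (A.σ x)) w) : A.isOver y = A.isOver w := by
  rw [(isSpecialBigon_iff.1 h).2, (isSpecialBigon_iff.1 h').2, A.isOver_σ _ h.1.next,
    A.isOver_σ x h.1, Bool.not_not]

theorem IsBigon.eq_opposite_of_sameCycle (h : A.IsBigon x y) (h' : A.IsBigon (A.σ (A.σ x)) w)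
    (hyw : A.σ.SameCycle y w) : w = A.σ (A.σ y) := by
  have hx : A.σ (A.σ x) ≠ x := h.isCrossing_left
  have hα := A.α_α x
  have hα' := A.α_α (A.σ (A.σ x))
  rw [h.α_left] at hα
  rw [h'.α_left] at hα'
  have hy := h.α_right
  have hw := h'.α_right
  rcases (A.sameCycle_iff y w).1 hyw with rfl | rfl | rfl | rfl
  · exact absurd (A.σ.injective (hw.symm.trans hy)) hx
  · grind [A.σ_four, A.σ_ne x]
  · rfl
  · grind [A.σ_four, A.σ_ne x]

theorem joinable_bigon_bigon_opposite (h : A.IsSpecialBigon x y)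
    (h' : A.IsSpecialBigon (A.σ (A.σ x)) w) :
    Joinable ((A.smooth x).smooth y) ((A.smooth (A.σ (A.σ x))).smooth w) := by
  refine Joinable.of_simplifies ?_ .refl ((A.smooth_opposite_isIso x).smooth w).iso.simplifies
  by_cases hyw : A.σ.SameCycle y w
  · obtain rfl := h.isBigon.eq_opposite_of_sameCycle h'.isBigon hyw
    have hσ : (A.smooth x).σ ((A.smooth x).σ y) = A.σ (A.σ y) := by
      have hxy := h.isBigon.not_sameCycle
      rw [smooth_σ_of_not_sameCycle hxy, smooth_σ_of_not_sameCycle (by simpa)]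
    exact hσ ▸ ((A.smooth x).smooth_opposite_isIso y).symm.iso.joinable
  · have hr := h.isBigon.resolvable
    have hxw : ¬ A.σ.SameCycle x w := by simpa using h'.isBigon.not_sameCycle
    obtain ⟨y, rfl⟩ := hr.range_coe.superset h.isBigon.not_sameCycle
    obtain ⟨w, rfl⟩ := hr.range_coe.superset hxw
    exact ((hr.isBigon_resolve h.isBigon h'.isBigon hyw).joinable_smooth
      (h.isOver_right h')).of_simplifies (hr.simplifies_smooth y) (hr.simplifies_smooth w)

theorem joinable_bigon_bigon_of_sameCycle (hA : ¬ A.HasSplitUnknotComponent)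
    (h : A.IsSpecialBigon x y) (h' : A.IsSpecialBigon z w) (hxz : A.σ.SameCycle x z) :
    Joinable ((A.smooth x).smooth y) ((A.smooth z).smooth w) := by
  rcases (A.sameCycle_iff x z).1 hxz with rfl | rfl | rfl | rfl
  · obtain rfl : w = y :=
      A.σ.injective (h'.isBigon.α_left.symm.trans h.isBigon.α_left)
    exact (iso_equivalence.refl _).joinable
  · exact absurd (hasSplitUnknotComponent_of_adjacent h h') hA
  · exact joinable_bigon_bigon_opposite h h'
  · exact absurd (hasSplitUnknotComponent_of_adjacent h' (by rwa [A.σ_four])) hA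

theorem joinable_bigon_bigon (hA : ¬ A.HasSplitUnknotComponent)
    (h : A.IsSpecialBigon x y) (h' : A.IsSpecialBigon z w) :
    Joinable ((A.smooth x).smooth y) ((A.smooth z).smooth w) := by
  have hcomm := h.smooth_comm.simplifies
  have hcomm' := h'.smooth_comm.simplifies
  by_cases hxz : A.σ.SameCycle x z
  · exact joinable_bigon_bigon_of_sameCycle hA h h' hxz
  by_cases hyz : A.σ.SameCycle y z
  · exact (joinable_bigon_bigon_of_sameCycle hA h.symm h' hyz).of_simplifies hcomm .refl
  by_cases hxw : A.σ.SameCycle x w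
  · exact (joinable_bigon_bigon_of_sameCycle hA h h'.symm hxw).of_simplifies .refl hcomm'
  by_cases hyw : A.σ.SameCycle y w
  · exact (joinable_bigon_bigon_of_sameCycle hA h.symm h'.symm hyw).of_simplifies hcomm hcomm'
  have hxw' : ¬ (A.smooth z).σ.SameCycle x w := fun h => hxw (sameCycle_of_smooth h)
  have hyw' : ¬ (A.smooth z).σ.SameCycle y w := fun h => hyw (sameCycle_of_smooth h)
  have hzw := (h'.smooth hxz hxw).smooth (fun h => hyz (sameCycle_of_smooth h))
    fun h => hyw (sameCycle_of_smooth h)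
  have hxy := (h.smooth (fun h => hxz h.symm) fun h => hyz h.symm).smooth
    (fun h => hxw' h.symm) fun h => hyw' h.symm
  have hiso : Iso ((((A.smooth x).smooth y).smooth z).smooth w)
      ((((A.smooth z).smooth w).smooth x).smooth y) :=
    iso_equivalence.trans ((smooth_smooth_smooth_comm hxz hyz).smooth w).iso
      (smooth_smooth_smooth_comm (A := A.smooth z) hxw' hyw').iso
  exact hiso.joinable.of_simplifies (Step.bigon hzw).simplifies (Step.bigon hxy).simplifies

end CriticalPairs

section Confluence

variable {B C : LinkDiagram X}

theorem Step.joinable (hA : ¬ A.HasSplitUnknotComponent) (hB : Step A B) (hC : Step A C) :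
    Joinable B C := by
  cases hB with
  | delete hu =>
    cases hC with
    | delete hw => exact hu.joinable_delete hw
    | monogon hz => exact hu.joinable_monogon hz
    | bigon hzw => exact hu.joinable_bigon hzw
  | monogon hx =>
    cases hC with
    | delete hw => exact (hw.joinable_monogon hx).symm
    | monogon hz => exact joinable_monogon_monogon hx hz
    | bigon hzw => exact joinable_monogon_bigon hx hzw
  | bigon hxy =>
    cases hC with
    | delete hw => exact (hw.joinable_bigon hxy).symm
    | monogon hz => exact (joinable_monogon_bigon hz hxy).symm
    | bigon hzw => exact joinable_bigon_bigon hA hxy hzw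

theorem SameLink.of_eqvGen (h : Relation.EqvGen (Step ⊔ Iso) A B) : SameLink A B := by
  refine (Relation.EqvGen.is_equivalence _).eqvGen_iff.1 (h.mono ?_)
  rintro A B (h | h)
  exacts [h.sameLink, .rel _ _ (.inl h.isotopic)]

theorem SameLink.hasSplitUnknotComponent_iff (h : SameLink A B) :
    A.HasSplitUnknotComponent ↔ B.HasSplitUnknotComponent :=
  ⟨fun hA => SameLink.hasSplitUnknotComponent (.symm _ _ h) hA, h.hasSplitUnknotComponent⟩

theorem isLocallyConfluentModulo_step (X : Ambient) : IsLocallyConfluentModulo (Step (X := X)) Iso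
    fun A => ¬ A.HasSplitUnknotComponent where
  equivalence := iso_equivalence
  bisimulation _ _ _ hA h := h.exists_step_of_iso hA
  wellFounded := wellFounded_swap_step
  invariant _ _ h := (SameLink.of_eqvGen (.rel _ _ h)).hasSplitUnknotComponent_iff.not
  join_of_rel _ _ _ := Step.joinable

theorem Isotopic.eqvGen (h : Isotopic A B) : Relation.EqvGen (Step ⊔ Iso) A B := by
  refine (Relation.EqvGen.is_equivalence _).eqvGen_iff.1 (h.mono ?_)
  rintro A B (h | h)
  · exact .rel _ _ (.inr h)
  · obtain ⟨u, hu, hiso⟩ := h.exists_delete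
    exact .trans _ _ _ (.rel _ _ (.inr hiso)) (.symm _ _ (.rel _ _ (.inl (.delete hu))))

theorem Reduces.eqvGen (h : Reduces A B) : Relation.EqvGen (Step ⊔ Iso) A B := by
  rcases h with ⟨E, x, hAE, hx, hEB⟩ | ⟨E, x, y, hAE, hxy, hEB⟩
  · exact .trans _ _ _ hAE.eqvGen (.trans _ _ _ (.rel _ _ (.inl (.monogon hx))) hEB.eqvGen)
  · exact .trans _ _ _ hAE.eqvGen (.trans _ _ _ (.rel _ _ (.inl (.bigon hxy))) hEB.eqvGen)

theorem eqvGen_step_of_eqvGen (h : Relation.EqvGen (Isotopic ⊔ Reduces) A B) :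
    Relation.EqvGen (Step ⊔ Iso) A B := by
  refine (Relation.EqvGen.is_equivalence _).eqvGen_iff.1 (h.mono ?_)
  rintro A B (h | h)
  exacts [h.eqvGen, h.eqvGen]

theorem IsMinimal.isotopic_of_simplifies (hA : A.IsMinimal) (h : Simplifies A B) :
    Isotopic A B := by
  induction h with
  | refl => exact .refl _
  | tail _ h ih =>
    rcases h with (hu | hx | hxy) | h
    · exact .trans _ _ _ ih hu.isotopic_delete
    · exact absurd (.inl ⟨_, _, ih, hx, .refl _⟩) (hA _)
    · exact absurd (.inr ⟨_, _, _, ih, hxy, .refl _⟩) (hA _)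
    · exact .trans _ _ _ ih h.isotopic

end Confluence

end LinkDiagram

theorem theorem1_general {X : Ambient} {D D₁ D₂ : LinkDiagram X}
    (hD : ¬ D.HasSplitUnknotComponent)
    (h₁ : Relation.EqvGen (LinkDiagram.Isotopic ⊔ LinkDiagram.Reduces) D D₁) (hm₁ : D₁.IsMinimal)
    (h₂ : Relation.EqvGen (LinkDiagram.Isotopic ⊔ LinkDiagram.Reduces) D D₂) (hm₂ : D₂.IsMinimal) :
    LinkDiagram.Isotopic D₁ D₂ := by
  have h₁' := LinkDiagram.eqvGen_step_of_eqvGen h₁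
  have h₂' := LinkDiagram.eqvGen_step_of_eqvGen h₂
  have hD₁ := (LinkDiagram.SameLink.of_eqvGen h₁').hasSplitUnknotComponent_iff.not.1 hD
  obtain ⟨E, hE₁, hE₂⟩ := (LinkDiagram.isLocallyConfluentModulo_step X).join_of_eqvGen hD₁
    (.trans _ _ _ (.symm _ _ h₁') h₂')
  exact .trans _ _ _ (hm₁.isotopic_of_simplifies hE₁) (.symm _ _ (hm₂.isotopic_of_simplifies hE₂))

theorem theorem1 (X : Ambient) (D D₁ D₂ : LinkDiagram X)
    (hD : ¬ D.HasSplitUnknotComponent)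
    (h₁ : Relation.ReflTransGen LinkDiagram.Reduces D D₁) (hm₁ : D₁.IsMinimal)
    (h₂ : Relation.ReflTransGen LinkDiagram.Reduces D D₂) (hm₂ : D₂.IsMinimal) :
    LinkDiagram.Isotopic D₁ D₂ := by
  exact theorem1_general hD (.mono (fun _ _ => .inr) _ _ (.reflTransGen_le_eqvGen _ _ _ h₁)) hm₁
    (.mono (fun _ _ => .inr) _ _ (.reflTransGen_le_eqvGen _ _ _ h₂)) hm₂
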